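/- Let $\Gamma$ be a metrized graph, i.e. a finite connected graph (multiple edges and self-loops allowed) with vertex set $V$, edge set $E$, and edges $e$ parametrized by segments of lengths $L_e>0$. Write $\ell(\Gamma)=\sum_{e} L_e$ for its total length, $g(\Gamma)=\#E-\#V+1$ for its genus and $\upsilon(p)$ for the valence of $p\in V$ (a loop counts twice). For $y,z\in\Gamma$ let $j_z(\cdot,y)$ be the continuous function on $\Gamma$, affine on edges away from $y$ and $z$, with $j_z(z,y)=0$ and $\Delta_x j_z(x,y)=\delta_y(x)-\delta_z(x)$, where $\Delta f=-f''\,dx-\sum_p\big(\sum_{\vec v\text{ at }p}d_{\vec v}f(p)\big)\delta_p$; let $r(x,y)=j_y(x,x)$ be the resistance function. Let $\mu_{can}$ be the unique signed Borel measure on $\Gamma$ of total mass $1$ for which $\int_\Gamma j_\zeta(x,x)\,d\mu_{can}(\zeta)$ does not depend on $x\in\Gamma$, and let the tau constant $\tau(\Gamma)$ be one half of this constant value. Let $\mathbf q:V\to\mathbb N=\{0,1,2,\dots\}$ be such that the canonical divisor $K=\sum_{p\in V}(\upsilon(p)-2+2\mathbf q(p))\,p$ is effective, so that $(\Gamma,\mathbf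 q)$ is a polarized metrized graph (pm-graph), and let $\bar g=g(\Gamma)+\sum_{p\in V}\mathbf q(p)$ be its genus. Put $\delta_K=\sum_{p\in V}(\upsilon(p)-2+2\mathbf q(p))\,\delta_p$ and $$\mu_{ad}=\frac1{\bar g}\Big(\sum_{p\in V}\mathbf q(p)\,\delta_p+\sum_{e\in E}\frac{dx}{L_e+R_e}\Big),$$ where $dx$ is Lebesgue measure on the edge $e$ and $R_e$ is the resistance between the end points of $e$ in the graph obtained by deleting the interior of $e$ ($R_e=\infty$, and the corresponding term is $0$, if that graph is disconnected). Define $$\theta(\Gamma)=\sum_{p,q\in V}(\upsilon(p)-2+2\mathbf q(p))(\upsilon(q)-2+2\mathbf q(q))\,r(p,q),$$ $$\epsilon(\Gamma)=\iint_{\Gamma\times\Gamma}r(x,y)\,\delta_K(x)\,\mu_{ad}(y),\qquad a(\Gamma)=\frac12\iint_{\Gamma\times\Gamma}r(x,y)\,\mu_{ad}(x)\,\mu_{ad}(y),$$ $$\varphi(\Gamma)=3\bar g\,a(\Gamma)-\tfrac14\big(\epsilon(\Gamma)+\ell(\Gamma)\big).$$ Then for every pm-graph $\Gamma$, $$\varphi(\Gamma)=\frac{(5\bar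 g-2)\,\tau(\Gamma)}{\bar g}+\frac{\theta(\Gamma)}{4\bar g}-\frac{\ell(\Gamma)}4,$$ and moreover $$\epsilon(\Gamma)=\frac{(4\bar g-4)\,\tau(\Gamma)}{\bar g}+\frac{\theta(\Gamma)}{2\bar g},\qquad a(\Gamma)=\frac{(2\bar g-1)\,\tau(\Gamma)}{\bar g^{2}}+\frac{\theta(\Gamma)}{8\bar g^{2}}.$$ -/

import Mathlib

open MeasureTheory Set Filter Topology
open scoped ENNReal

noncomputable section

/-- Combinatorial data of a finite graph with positive edge lengths, relative to a vertex set `V`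
and an edge set `E`. Multiple edges and self-loops are allowed. The edge `e` is parametrized by
`[0, len e]`, from `src e` to `tgt e`. Connectedness is imposed separately, because deleting the
interior of an edge may disconnect the graph. -/
structure LengthGraph (V E : Type*) where
  src : E → V
  tgt : E → V
  len : E → ℝ
  len_pos : ∀ e, 0 < len e

namespace LengthGraph

variable {V E : Type*}

/-- The graph is non-empty and any two vertices are joined by a chain of edges. -/
def Connected (G : LengthGraph V E) : Prop :=
  Nonempty V ∧ ∀ p q : V, Relation.EqvGen (fun a b => ∃ e, G.src e = a ∧ G.tgt e = b) p q

/-- The points of the geometric realization: the vertices and the interior points of edges. -/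
inductive Point (G : LengthGraph V E) where
  | vertex (p : V) : Point G
  | inner (e : E) (s : Ioo (0 : ℝ) (G.len e)) : Point G

open Classical in
/-- The parametrization `[0, len e] → Γ` of the closed edge `e` (constant outside `[0, len e]`). -/
def edgeMap (G : LengthGraph V E) (e : E) (s : ℝ) : G.Point :=
  if h : s ∈ Ioo (0 : ℝ) (G.len e) then Point.inner e ⟨s, h⟩
  else if s ≤ 0 then Point.vertex (G.src e) else Point.vertex (G.tgt e)

/-- The quotient topology: a set of points is open iff its preimage in each closed segment
`[0, len e]` is open. -/
instance (G : LengthGraph V E) : TopologicalSpace G.Point :=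
  ⨆ e : E, TopologicalSpace.coinduced
    (fun s : Icc (0 : ℝ) (G.len e) => G.edgeMap e s) inferInstance

/-- The Borel sets of the geometric realization. -/
instance (G : LengthGraph V E) : MeasurableSpace G.Point := borel G.Point

instance (G : LengthGraph V E) : BorelSpace G.Point := ⟨rfl⟩

/-- The valence of a vertex: the number of directions emanating from it (a loop counts twice). -/
def valence (G : LengthGraph V E) (p : V) : ℕ :=
  Nat.card {e // G.src e = p} + Nat.card {e // G.tgt e = p}

/-- The total length. -/
def totalLength [Fintype E] (G : LengthGraph V E) : ℝ := ∑ e, G.len e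

/-- The first Betti number `#E - #V + 1` of a connected graph. -/
def genus [Fintype V] [Fintype E] (_G : LengthGraph V E) : ℤ :=
  (Fintype.card E : ℤ) - Fintype.card V + 1

/-- The graph obtained by deleting the interior of the edge `e`. -/
def deleteEdge (G : LengthGraph V E) (e : E) : LengthGraph V {e' : E // e' ≠ e} where
  src e' := G.src e'
  tgt e' := G.tgt e'
  len e' := G.len e'
  len_pos e' := G.len_pos e'

open Classical in
/-- The sum `∑ d_v f(p)` of the one-sided derivatives of `f` at the point `p`, over all directions
`v` emanating from `p`. -/
def slopeSum [Fintype E] (G : LengthGraph V E) (f : G.Point → ℝ) : G.Point → ℝ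
  | .vertex p =>
      ∑ e, ((if G.src e = p then derivWithin (fun t => f (G.edgeMap e t)) (Ici 0) 0 else 0)
        + (if G.tgt e = p then
            -derivWithin (fun t => f (G.edgeMap e t)) (Iic (G.len e)) (G.len e) else 0))
  | .inner e s =>
      derivWithin (fun t => f (G.edgeMap e t)) (Ici s.1) s.1
        - derivWithin (fun t => f (G.edgeMap e t)) (Iic s.1) s.1

open Classical in
/-- `f = j_z(·, y)`: the function `f` is continuous, vanishes at `z`, and its measure-valued
Laplacian `Δf = -f'' dx - ∑_p (∑_v d_v f(p)) δ_p` equals `δ_y - δ_z`. That is, `f'' = 0` away from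
the vertices and from `y`, `z`, and the point masses of `Δf` are those of `δ_y - δ_z`. -/
structure IsVoltage [Fintype E] (G : LengthGraph V E) (z y : G.Point) (f : G.Point → ℝ) :
    Prop where
  continuous : Continuous f
  ground : f z = 0
  locally_affine : ∀ e, ∀ s ∈ Ioo (0 : ℝ) (G.len e), G.edgeMap e s ≠ y → G.edgeMap e s ≠ z →
    ∃ m : ℝ, ∀ᶠ t in 𝓝 s, f (G.edgeMap e t) = f (G.edgeMap e s) + m * (t - s)
  point_mass : ∀ p, -G.slopeSum f p = (if p = y then 1 else 0) - (if p = z then 1 else 0)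

open Classical in
/-- The voltage function `j_z(x, y)` (on a connected graph). -/
def voltage [Fintype E] (G : LengthGraph V E) (z x y : G.Point) : ℝ :=
  if h : ∃ f, G.IsVoltage z y f then h.choose x else 0

/-- The resistance function `r(x, y) = j_y(x, x)`. -/
def resistance [Fintype E] (G : LengthGraph V E) (x y : G.Point) : ℝ := G.voltage y x x

open Classical in
/-- `R_e`: the resistance between the end points of `e` after the interior of `e` is deleted; it is
infinite if the deletion disconnects the graph. -/
def deletedResistance [Fintype E] (G : LengthGraph V E) (e : E) : ℝ≥0∞ :=
  if (G.deleteEdge e).Connected then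
    ENNReal.ofReal ((G.deleteEdge e).resistance (.vertex (G.src e)) (.vertex (G.tgt e)))
  else ⊤

/-- Lebesgue measure `dx` on the edge `e`, as a measure on the whole graph. -/
def edgeMeasure (G : LengthGraph V E) (e : E) : Measure G.Point :=
  (volume.restrict (Icc (0 : ℝ) (G.len e))).map (G.edgeMap e)

/-- `j_μ(x, y) = ∫ j_ζ(x, y) dμ(ζ)` for a finite signed Borel measure `μ`. -/
def voltageInt [Fintype E] (G : LengthGraph V E) (μ : SignedMeasure G.Point) (x y : G.Point) : ℝ :=
  ∫ᵛ ζ, G.voltage ζ x y ∂•μ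

/-- The defining property of the canonical measure: `μ` is a finite signed Borel measure of total
mass `1` such that `j_μ(x, x)` is constant. -/
def IsCanonicalMeasure [Fintype E] (G : LengthGraph V E) (μ : SignedMeasure G.Point) : Prop :=
  μ univ = 1 ∧ ∃ c : ℝ, ∀ x, G.voltageInt μ x x = c

/-- `t` is the constant value of `(1/2) j_μ(x, x)` for the canonical measure `μ`. -/
def IsTauConstant [Fintype E] (G : LengthGraph V E) (t : ℝ) : Prop :=
  ∃ μ, G.IsCanonicalMeasure μ ∧ ∀ x, t = 1 / 2 * G.voltageInt μ x x

open Classical in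
/-- The tau constant `τ(Γ)`. -/
def tau [Fintype E] (G : LengthGraph V E) : ℝ :=
  if h : ∃ t, G.IsTauConstant t then h.choose else 0

end LengthGraph

/-- A polarized metrized graph: a finite connected metrized graph (multiple edges and loops allowed)
with a function `q : V → ℕ` such that the canonical divisor `∑ (υ(p) - 2 + 2 q(p)) p` is
effective. -/
structure PMGraph (V E : Type*) extends LengthGraph V E where
  connected : toLengthGraph.Connected
  q : V → ℕ
  effective : ∀ p, (0 : ℤ) ≤ (toLengthGraph.valence p : ℤ) - 2 + 2 * q p

namespace PMGraph

variable {V E : Type*}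

/-- The coefficient `υ(p) - 2 + 2 q(p)` of the canonical divisor `K` at the vertex `p`. -/
def canDiv (Γ : PMGraph V E) (p : V) : ℤ := (Γ.valence p : ℤ) - 2 + 2 * Γ.q p

/-- The genus `ḡ = g(Γ) + ∑ q(p)`. -/
def gbar [Fintype V] [Fintype E] (Γ : PMGraph V E) : ℝ :=
  ((Γ.genus + ∑ p, (Γ.q p : ℤ) : ℤ) : ℝ)

/-- The discrete measure `δ_K = ∑ (υ(p) - 2 + 2 q(p)) δ_p`. -/
def deltaK [Fintype V] (Γ : PMGraph V E) : SignedMeasure Γ.Point :=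
  ∑ p, VectorMeasure.dirac (.vertex p) (Γ.canDiv p : ℝ)

/-- The admissible measure `μ_ad = (1/ḡ) (∑_p q(p) δ_p + ∑_e dx / (L_e + R_e))`. -/
def admMeasure [Fintype V] [Fintype E] (Γ : PMGraph V E) : Measure Γ.Point :=
  ENNReal.ofReal (1 / Γ.gbar) •
    (∑ p, (Γ.q p : ℝ≥0∞) • Measure.dirac (.vertex p)
      + ∑ e, (ENNReal.ofReal (Γ.len e) + Γ.deletedResistance e)⁻¹ • Γ.edgeMeasure e)

/-- `θ(Γ) = ∑_{p,q} (υ(p) - 2 + 2 q(p)) (υ(q) - 2 + 2 q(q)) r(p, q)`. -/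
def theta [Fintype V] [Fintype E] (Γ : PMGraph V E) : ℝ :=
  ∑ p, ∑ q, (Γ.canDiv p : ℝ) * (Γ.canDiv q : ℝ) * Γ.resistance (.vertex p) (.vertex q)

/-- `ε(Γ) = ∬ r(x, y) δ_K(x) μ_ad(y)`. -/
def epsilon [Fintype V] [Fintype E] (Γ : PMGraph V E) : ℝ :=
  ∫ y, (∫ᵛ x, Γ.resistance x y ∂•Γ.deltaK) ∂Γ.admMeasure

/-- `a(Γ) = (1/2) ∬ r(x, y) μ_ad(x) μ_ad(y)`. -/
def aInv [Fintype V] [Fintype E] (Γ : PMGraph V E) : ℝ :=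
  1 / 2 * ∫ y, (∫ x, Γ.resistance x y ∂Γ.admMeasure) ∂Γ.admMeasure

/-- `φ(Γ) = 3 ḡ a(Γ) - (1/4) (ε(Γ) + ℓ(Γ))`. -/
def phi [Fintype V] [Fintype E] (Γ : PMGraph V E) : ℝ :=
  3 * Γ.gbar * Γ.aInv - 1 / 4 * (Γ.epsilon + Γ.totalLength)

end PMGraph

end

/-! Everything is reduced to one explicit kernel. On the vertices, a Green function `g` of the
weighted Laplacian is obtained by linear algebra. Interpolating `g` affinely along edges in both
variables and adding the Dirichlet Green functions of the edges gives a kernel `green` on all of Γ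
with Laplacian `δ_y - δ_{z₀}`. Since voltage functions are unique, `r(x,y) = green x x - 2 green x y
+ green y y`.

Take `μ = ∑ (1 - υ(p)/2) δ_p + ∑ dx/(L_e + R_e)`. The parallel law turns `1/(L_e + R_e)` into `(1 -
r_e/L_e)/L_e`, where `r_e` is the resistance in Γ between the ends of `e`. With these weights `green
x x - 2 ∫ green x dμ` is constant (`IsGreen.green_self_sub_canInt`): on vertices both terms have the
same Laplacian, and along an edge their quadratic parts cancel. Hence `∫ r(x,·) dμ` is constant and
`μ` is canonical. Pairing `μ` with any other canonical measure through the symmetric kernel `r` and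
using Fubini shows that both give the same constant, so it is `2τ` (`Connected.canInt_resistance`).

Finally `q = (1 - υ/2) + (υ - 2 + 2q)/2`, that is, `μ_ad = (μ + δ_K/2)/ḡ`
(`PMGraph.integral_admMeasure`). So `∫ r(y,·) dμ_ad = (2τ + ½ ∑ K(p) r(y,p))/ḡ`. Integrating in `y`
against `δ_K`, of degree `2ḡ - 2`, gives `ε`; integrating against `μ_ad`, of mass 1, gives `a`; and
`φ` is a combination of the two. -/

noncomputable section

namespace LengthGraph

variable {V E : Type*}

/-! ### Discrete potential theory on the vertices. -/

section Discrete

open Classical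

lemma Connected.eq_of_forall_edge {G : LengthGraph V E} {φ : V → ℝ} (hG : G.Connected)
    (h : ∀ e, φ (G.src e) = φ (G.tgt e)) (p q : V) : φ p = φ q := by
  induction hG.2 p q with
  | rel _ _ h' => obtain ⟨e, rfl, rfl⟩ := h'; exact h e
  | refl _ => rfl
  | symm _ _ _ ih => exact ih.symm
  | trans _ _ _ _ _ ih₁ ih₂ => exact ih₁.trans ih₂

variable [Fintype E] (G : LengthGraph V E)

/-- The weighted Laplacian of a function on the vertices. -/
def lap (φ : V → ℝ) (p : V) : ℝ :=
  ∑ e, (φ (G.src e) - φ (G.tgt e)) / G.len e *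
    ((if G.src e = p then 1 else 0) - (if G.tgt e = p then 1 else 0))

lemma lap_add (φ ψ : V → ℝ) (p : V) :
    G.lap (fun v => φ v + ψ v) p = G.lap φ p + G.lap ψ p := by
  simp only [lap, ← Finset.sum_add_distrib]
  exact Finset.sum_congr rfl fun e _ => by ring

lemma lap_const_mul (c : ℝ) (φ : V → ℝ) (p : V) :
    G.lap (fun v => c * φ v) p = c * G.lap φ p := by
  simp only [lap, Finset.mul_sum]
  exact Finset.sum_congr rfl fun e _ => by ring

lemma lap_sum {ι : Type*} (s : Finset ι) (φ : ι → V → ℝ) (p : V) :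
    G.lap (fun v => ∑ i ∈ s, φ i v) p = ∑ i ∈ s, G.lap (φ i) p := by
  simp only [lap]
  rw [Finset.sum_comm]
  refine Finset.sum_congr rfl fun e _ => ?_
  rw [← Finset.sum_mul, ← Finset.sum_div, Finset.sum_sub_distrib]

/-- `g` is the Green function on the vertices, grounded at `z`. -/
structure IsGreen (G : LengthGraph V E) (z : V) (g : V → V → ℝ) : Prop where
  symm : ∀ p q, g p q = g q p
  lap_eq : ∀ p q, G.lap (fun v => g v q) p = (if p = q then 1 else 0) - (if p = z then 1 else 0)

namespace IsGreen

variable {G} {z : V} {g : V → V → ℝ}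

/-- For an edge from `p` to `q`, `g p p - g q q = 2 (g p p - g q p) - (g p p - 2 g p q + g q q)`;
the first part sums to twice the Laplacian of `g · p` at `p`. A loop contributes zero to every term.
-/
lemma lap_diag (hg : G.IsGreen z g) (p : V) :
    G.lap (fun v => g v v) p = 2 * (1 - if p = z then 1 else 0)
      - ∑ e, (g (G.src e) (G.src e) - 2 * g (G.src e) (G.tgt e) + g (G.tgt e) (G.tgt e)) / G.len e
        * ((if G.src e = p then 1 else 0) + (if G.tgt e = p then 1 else 0)) := by
  have h := hg.lap_eq p p
  rw [if_pos rfl] at h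
  rw [← h, lap, lap, Finset.mul_sum, ← Finset.sum_sub_distrib]
  refine Finset.sum_congr rfl fun e _ => ?_
  have hs := hg.symm (G.src e) (G.tgt e)
  by_cases h1 : G.src e = p <;> by_cases h2 : G.tgt e = p
  · rw [h1, h2]; ring
  · rw [if_pos h1, if_neg h2, h1]; rw [h1] at hs; rw [hs]; ring
  · rw [if_neg h1, if_pos h2, h2]; rw [h2] at hs; ring
  · simp [h1, h2]

/-- The vertex weights of the canonical measure, with the mass of each edge moved to its ends. -/
def mass (G : LengthGraph V E) (g : V → V → ℝ) (p : V) : ℝ :=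
  1 - 1 / 2 * ∑ e, (g (G.src e) (G.src e) - 2 * g (G.src e) (G.tgt e) + g (G.tgt e) (G.tgt e))
    / G.len e * ((if G.src e = p then 1 else 0) + (if G.tgt e = p then 1 else 0))

lemma lap_diag' (hg : G.IsGreen z g) (p : V) :
    G.lap (fun v => g v v) p = 2 * mass G g p - 2 * if p = z then 1 else 0 := by
  rw [hg.lap_diag, mass]; ring

end IsGreen

variable [Fintype V]

lemma sum_mul_lap (φ ψ : V → ℝ) :
    ∑ p, ψ p * G.lap φ p =
      ∑ e, (φ (G.src e) - φ (G.tgt e)) * (ψ (G.src e) - ψ (G.tgt e)) / G.len e := by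
  simp only [lap, Finset.mul_sum]
  rw [Finset.sum_comm]
  refine Finset.sum_congr rfl fun e _ => ?_
  have h : ∀ p, ψ p * ((φ (G.src e) - φ (G.tgt e)) / G.len e *
      ((if G.src e = p then 1 else 0) - (if G.tgt e = p then 1 else 0))) =
      (φ (G.src e) - φ (G.tgt e)) / G.len e *
      ((if G.src e = p then ψ p else 0) - (if G.tgt e = p then ψ p else 0)) := by
    intro p; split_ifs <;> ring
  simp only [h]
  rw [← Finset.mul_sum, Finset.sum_sub_distrib]
  simp only [Finset.sum_ite_eq, Finset.mem_univ, if_true]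
  ring

lemma sum_mul_lap_comm (φ ψ : V → ℝ) : ∑ p, ψ p * G.lap φ p = ∑ p, φ p * G.lap ψ p := by
  rw [sum_mul_lap, sum_mul_lap]
  exact Finset.sum_congr rfl fun e _ => by ring

lemma sum_lap (φ : V → ℝ) : ∑ p, G.lap φ p = 0 := by
  simpa using G.sum_mul_lap φ (fun _ => 1)

variable {G}

/-- The Dirichlet energy of `φ` vanishes, so `φ` does not change along any edge. -/
lemma Connected.eq_of_lap_eq_zero {φ : V → ℝ} (hG : G.Connected)
    (h : ∀ p, G.lap φ p = 0) (p q : V) : φ p = φ q := by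
  refine hG.eq_of_forall_edge (fun e => ?_) p q
  have h0 := G.sum_mul_lap φ φ
  simp only [h, mul_zero, Finset.sum_const_zero] at h0
  have h1 := (Finset.sum_eq_zero_iff_of_nonneg (fun e _ =>
    div_nonneg (mul_self_nonneg _) (G.len_pos e).le)).1 h0.symm e (Finset.mem_univ e)
  have h2 := (div_eq_zero_iff.1 h1).resolve_right (G.len_pos e).ne'
  exact sub_eq_zero.1 (mul_self_eq_zero.1 h2)

lemma Connected.exists_isGreen (hG : G.Connected) : ∃ z g, G.IsGreen z g := by
  obtain ⟨z⟩ := hG.1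
  -- The Laplacian kills constants; the rank-one term at `z` makes it injective, since summing `M φ`
  -- over the vertices recovers `φ z`.
  let M : (V → ℝ) →ₗ[ℝ] (V → ℝ) :=
    { toFun := fun φ p => G.lap φ p + if p = z then φ z else 0
      map_add' := fun φ ψ => by
        ext p
        have := G.lap_add φ ψ p
        simp only [Pi.add_apply]
        change G.lap (fun v => φ v + ψ v) p + _ = _
        rw [this]; split_ifs <;> ring
      map_smul' := fun c φ => by
        ext p
        have := G.lap_const_mul c φ p
        simp only [Pi.smul_apply, smul_eq_mul, RingHom.id_apply]
        change G.lap (fun v => c * φ v) p + _ = _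
        rw [this]; split_ifs <;> ring }
  have hM : ∀ φ p, M φ p = G.lap φ p + if p = z then φ z else 0 := fun _ _ => rfl
  have hsum : ∀ φ, ∑ p, M φ p = φ z := fun φ => by
    simp [hM, Finset.sum_add_distrib, G.sum_lap]
  have hinj : Function.Injective M := by
    rw [injective_iff_map_eq_zero]
    intro φ hφ
    have hz : φ z = 0 := by rw [← hsum φ, hφ]; simp
    have hl : ∀ p, G.lap φ p = 0 := fun p => by
      have := congrFun hφ p
      simpa [hM, hz] using this
    ext p
    rw [hG.eq_of_lap_eq_zero hl p z, hz]; rfl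
  have hsurj := LinearMap.injective_iff_surjective.1 hinj
  choose k hk using fun q : V => hsurj (fun p => if p = q then 1 else 0)
  -- The value at `z` is 1 rather than 0. This is harmless: an additive constant in `g` cancels in
  -- resistances.
  have hkz : ∀ q, k q z = 1 := fun q => by rw [← hsum (k q), hk]; simp
  have hlap : ∀ p q, G.lap (k q) p = (if p = q then 1 else 0) - (if p = z then 1 else 0) := by
    intro p q
    have := congrFun (hk q) p
    rw [hM, hkz] at this
    linarith
  refine ⟨z, fun p q => k q p, fun p q => ?_, hlap⟩
  -- Self-adjointness of the Laplacian reads `k p q - 1 = k q p - 1`.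
  have := G.sum_mul_lap_comm (k p) (k q)
  simp only [hlap, mul_sub, mul_ite, mul_one, mul_zero, Finset.sum_sub_distrib,
    Finset.sum_ite_eq', Finset.mem_univ, if_true, hkz] at this
  linarith

namespace IsGreen

variable {z : V} {g : V → V → ℝ}

/-- A potential with unit current from `a` to `b` computes the resistance between `a` and `b`. -/
lemma resistance_eq (hG : G.Connected) (hg : G.IsGreen z g) {f : V → ℝ} {a b : V} {c : ℝ}
    (hf : ∀ p, G.lap f p = c * ((if p = a then 1 else 0) - (if p = b then 1 else 0))) :
    c * (g a a - 2 * g a b + g b b) = f a - f b := by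
  have hl : ∀ p, G.lap (fun v => f v + (-c) * (g v a + (-1) * g v b)) p = 0 := by
    intro p
    rw [lap_add, lap_const_mul, lap_add, lap_const_mul, hf, hg.lap_eq, hg.lap_eq]
    ring
  have := hG.eq_of_lap_eq_zero hl a b
  have hs := hg.symm a b
  linear_combination -this - c * hs

/-- A form of Foster's theorem: the Laplacian of the diagonal sums to zero. -/
lemma sum_mass (hg : G.IsGreen z g) : ∑ p, mass G g p = 1 := by
  have h := G.sum_lap (fun v => g v v)
  simp only [hg.lap_diag', Finset.sum_sub_distrib, ← Finset.mul_sum] at h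
  simp only [Finset.sum_ite_eq', Finset.mem_univ, if_true] at h
  linarith

/-- Both terms have Laplacian `2 mass - 2 δ_z`, the second because the masses sum to 1; so their
difference is harmonic. -/
lemma diag_sub_const (hG : G.Connected) (hg : G.IsGreen z g) (p q : V) :
    g p p - 2 * ∑ v, mass G g v * g p v = g q q - 2 * ∑ v, mass G g v * g q v := by
  have key : ∀ p, G.lap (fun u => g u u + (-2) * ∑ v, mass G g v * g u v) p = 0 := by
    intro p
    rw [lap_add, lap_const_mul, lap_sum]
    simp only [lap_const_mul, hg.lap_eq, hg.lap_diag']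
    simp only [mul_sub, Finset.sum_sub_distrib, ← Finset.sum_mul, hg.sum_mass]
    simp only [mul_ite, mul_one, mul_zero, Finset.sum_ite_eq, Finset.mem_univ, if_true]
    split_ifs <;> ring
  have := hG.eq_of_lap_eq_zero key p q
  linarith

end IsGreen

end Discrete

end LengthGraph

/-! ### Piecewise affine functions of one variable. -/

section OneSided

variable {F : ℝ → ℝ} {a b s : ℝ}

/-- A continuous function on a segment that is locally affine in the interior is affine. -/
lemma exists_affine_of_locally_affine (hF : ContinuousOn F (Icc a b))
    (h : ∀ s ∈ Ioo a b, ∃ m : ℝ, ∀ᶠ t in 𝓝 s, F t = F s + m * (t - s)) :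
    ∃ m : ℝ, ∀ t ∈ Icc a b, F t = F a + m * (t - a) := by
  have hd : ∀ s ∈ Ioo a b, ∃ m : ℝ, HasDerivAt F m s ∧ ∀ᶠ t in 𝓝 s, deriv F t = m := by
    intro s hs
    obtain ⟨m, hm⟩ := h s hs
    have hder : ∀ t, HasDerivAt (fun t => F s + m * (t - s)) m t := fun t => by
      simpa using (((hasDerivAt_id t).sub_const s).const_mul m).const_add (F s)
    refine ⟨m, (hder s).congr_of_eventuallyEq hm, ?_⟩
    filter_upwards [eventually_eventually_nhds.2 hm] with t ht
    exact ((hder t).congr_of_eventuallyEq ht).deriv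
  have hd' : ∀ s ∈ Ioo a b, HasDerivAt (deriv F) 0 s := fun s hs => by
    obtain ⟨m, -, hm⟩ := hd s hs
    exact (hasDerivAt_const s m).congr_of_eventuallyEq hm
  have hc : ∃ m, ∀ t ∈ Ioo a b, deriv F t = m :=
    isOpen_Ioo.exists_is_const_of_deriv_eq_zero isPreconnected_Ioo
      (fun s hs => (hd' s hs).differentiableAt.differentiableWithinAt)
      (fun s hs => (hd' s hs).deriv)
  obtain ⟨m, hm⟩ := hc
  refine ⟨m, fun t ht => ?_⟩
  rcases ht.1.eq_or_lt with rfl | hat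
  · simp
  obtain ⟨c, hc, hce⟩ := exists_deriv_eq_slope F hat (hF.mono (Icc_subset_Icc_right ht.2))
    (fun s hs => by
      obtain ⟨m, hm, -⟩ := hd s ⟨hs.1, hs.2.trans_le ht.2⟩
      exact hm.differentiableAt.differentiableWithinAt)
  rw [hm c ⟨hc.1, hc.2.trans_le ht.2⟩, eq_div_iff (sub_pos.2 hat).ne'] at hce
  linarith

lemma hasDerivWithinAt_affine {S : Set ℝ} {m : ℝ}
    (h : ∀ᶠ t in 𝓝[S] s, F t = F s + m * (t - s)) : HasDerivWithinAt F m S s := by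
  have : HasDerivWithinAt (fun t => F s + m * (t - s)) m S s := by
    simpa using (((hasDerivWithinAt_id s S).sub_const s).const_mul m).const_add (F s)
  exact this.congr_of_eventuallyEq h (by simp)

/-- The finite set `S` misses a punctured neighbourhood of `s`, so the previous affineness lemma
applies on a short segment starting at `s`, even when `s` itself lies in `S`. -/
lemma exists_right_affine {S : Set ℝ} (hS : S.Finite) (hF : ContinuousOn F (Icc a b))
    (h : ∀ s ∈ Ioo a b, s ∉ S → ∃ m : ℝ, ∀ᶠ t in 𝓝 s, F t = F s + m * (t - s))
    (hs : s ∈ Ico a b) : ∃ m : ℝ, ∀ᶠ t in 𝓝[≥] s, F t = F s + m * (t - s) := by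
  have h1 : ∀ᶠ t in 𝓝 s, t ∉ S \ {s} := (hS.subset sdiff_subset).isClosed.isOpen_compl.mem_nhds
    (by simp)
  have h2 : ∀ᶠ t in 𝓝 s, t < b := Iio_mem_nhds hs.2
  obtain ⟨ε, hε, hball⟩ := Metric.eventually_nhds_iff.1 (h1.and h2)
  have hmem : ∀ t ∈ Icc s (s + ε / 2), t ∉ S \ {s} ∧ t < b := fun t ht => by
    apply hball
    rw [Real.dist_eq, abs_lt]
    constructor <;> linarith [ht.1, ht.2]
  have hlt : s < s + ε / 2 := by linarith
  obtain ⟨m, hm⟩ := exists_affine_of_locally_affine (F := F)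
    (hF.mono fun t ht => ⟨hs.1.trans ht.1, (hmem t ht).2.le⟩) (fun t ht => by
      have := hmem t (Ioo_subset_Icc_self ht)
      exact h t ⟨hs.1.trans_lt ht.1, this.2⟩ fun ht' => this.1 ⟨ht', ht.1.ne'⟩)
  exact ⟨m, Filter.mem_of_superset (Icc_mem_nhdsGE hlt) hm⟩

lemma exists_left_affine {S : Set ℝ} (hS : S.Finite) (hF : ContinuousOn F (Icc a b))
    (h : ∀ s ∈ Ioo a b, s ∉ S → ∃ m : ℝ, ∀ᶠ t in 𝓝 s, F t = F s + m * (t - s))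
    (hs : s ∈ Ioc a b) : ∃ m : ℝ, ∀ᶠ t in 𝓝[≤] s, F t = F s + m * (t - s) := by
  have h1 : ∀ᶠ t in 𝓝 s, t ∉ S \ {s} := (hS.subset sdiff_subset).isClosed.isOpen_compl.mem_nhds
    (by simp)
  have h2 : ∀ᶠ t in 𝓝 s, a < t := Ioi_mem_nhds hs.1
  obtain ⟨ε, hε, hball⟩ := Metric.eventually_nhds_iff.1 (h1.and h2)
  have hmem : ∀ t ∈ Icc (s - ε / 2) s, t ∉ S \ {s} ∧ a < t := fun t ht => by
    apply hball
    rw [Real.dist_eq, abs_lt]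
    constructor <;> linarith [ht.1, ht.2]
  have hlt : s - ε / 2 < s := by linarith
  obtain ⟨m, hm⟩ := exists_affine_of_locally_affine (F := F)
    (hF.mono fun t ht => ⟨(hmem t ht).2.le, ht.2.trans hs.2⟩) (fun t ht => by
      have := hmem t (Ioo_subset_Icc_self ht)
      exact h t ⟨this.2, ht.2.trans_le hs.2⟩ fun ht' => this.1 ⟨ht', ht.2.ne⟩)
  refine ⟨m, Filter.mem_of_superset (Icc_mem_nhdsLE hlt) fun t ht => ?_⟩
  have e1 := hm t ht
  have e2 := hm s (right_mem_Icc.2 hlt.le)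
  change F t = _
  linarith

-- Strict inequality here, weak inequality in the left-sided version: the slope drop of 1 at `s = p`
-- is the point mass of the Green kernel.
open Classical in
lemma hasDerivWithinAt_min_Ici (p s : ℝ) :
    HasDerivWithinAt (fun t => min t p) (if s < p then 1 else 0) (Ici s) s := by
  apply hasDerivWithinAt_affine
  split_ifs with h
  · filter_upwards [mem_nhdsWithin_of_mem_nhds (Iio_mem_nhds h)] with t ht
    rw [min_eq_left (le_of_lt ht), min_eq_left h.le]; ring
  · filter_upwards [self_mem_nhdsWithin] with t ht
    rw [min_eq_right ((not_lt.1 h).trans ht), min_eq_right (not_lt.1 h)]; ring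

open Classical in
lemma hasDerivWithinAt_min_Iic (p s : ℝ) :
    HasDerivWithinAt (fun t => min t p) (if s ≤ p then 1 else 0) (Iic s) s := by
  apply hasDerivWithinAt_affine
  split_ifs with h
  · filter_upwards [self_mem_nhdsWithin] with t ht
    rw [min_eq_left ((show t ≤ s from ht).trans h), min_eq_left h]; ring
  · filter_upwards [mem_nhdsWithin_of_mem_nhds (Ioi_mem_nhds (not_le.1 h))] with t ht
    rw [min_eq_right (le_of_lt ht), min_eq_right (not_le.1 h).le]; ring

end OneSided

namespace LengthGraph

variable {V E : Type*} (G : LengthGraph V E)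

/-! ### Topology of the geometric realization. -/

section Edges

variable {G} (e : E)

lemma edgeMap_of_mem {s : ℝ} (hs : s ∈ Ioo (0 : ℝ) (G.len e)) :
    G.edgeMap e s = .inner e ⟨s, hs⟩ := by simp only [edgeMap, dif_pos hs]

lemma edgeMap_of_nonpos {s : ℝ} (hs : s ≤ 0) : G.edgeMap e s = .vertex (G.src e) := by
  rw [edgeMap, dif_neg fun h => hs.not_gt h.1, if_pos hs]

lemma edgeMap_of_len_le {s : ℝ} (hs : G.len e ≤ s) : G.edgeMap e s = .vertex (G.tgt e) := by
  rw [edgeMap, dif_neg fun h => hs.not_gt h.2, if_neg ((G.len_pos e).trans_le hs).not_ge]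

lemma edgeMap_zero : G.edgeMap e 0 = .vertex (G.src e) := edgeMap_of_nonpos e le_rfl

lemma edgeMap_len : G.edgeMap e (G.len e) = .vertex (G.tgt e) := edgeMap_of_len_le e le_rfl

lemma edgeMap_injOn : InjOn (G.edgeMap e) (Ioo 0 (G.len e)) := by
  intro s hs t ht h
  rw [edgeMap_of_mem e hs, edgeMap_of_mem e ht] at h
  injection h with _ h
  exact congrArg Subtype.val h

lemma edgeMap_projIcc (s : ℝ) :
    G.edgeMap e (projIcc 0 (G.len e) (G.len_pos e).le s) = G.edgeMap e s := by
  rcases le_total s 0 with h | h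
  · rw [projIcc_of_le_left _ h, edgeMap_of_nonpos e h]; exact edgeMap_zero e
  rcases le_total (G.len e) s with h' | h'
  · rw [projIcc_of_right_le _ h', edgeMap_of_len_le e h']; exact edgeMap_len e
  · rw [projIcc_of_mem _ ⟨h, h'⟩]

lemma continuous_edgeMap : Continuous (G.edgeMap e) := by
  have h : Continuous (fun s : Icc (0 : ℝ) (G.len e) => G.edgeMap e s) :=
    continuous_iSup_rng (i := e) continuous_coinduced_rng
  have := h.comp (continuous_projIcc (h := (G.len_pos e).le))
  exact this.congr (edgeMap_projIcc e)

lemma continuous_of_edges {Z : Type*} [TopologicalSpace Z] {f : G.Point → Z}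
    (h : ∀ e, ContinuousOn (fun s => f (G.edgeMap e s)) (Icc 0 (G.len e))) : Continuous f :=
  continuous_iSup_dom.2 fun e => continuous_coinduced_dom.2 (h e).domRestrict

lemma Point.induction {P : G.Point → Prop} (hv : ∀ p, P (.vertex p))
    (he : ∀ e, ∀ s ∈ Ioo 0 (G.len e), P (G.edgeMap e s)) (x : G.Point) : P x := by
  cases x with
  | vertex p => exact hv p
  | inner e s => rw [← edgeMap_of_mem e s.2]; exact he e s s.2

end Edges

/-! ### Uniqueness of voltage functions. -/

section Voltage

open Classical

variable {G} [Fintype E] {z y : G.Point} {f k : G.Point → ℝ}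

namespace IsVoltage

lemma right_affine (hf : G.IsVoltage z y f) (e : E) {s : ℝ} (hs : s ∈ Ico 0 (G.len e)) :
    ∃ m : ℝ, ∀ᶠ t in 𝓝[≥] s, f (G.edgeMap e t) = f (G.edgeMap e s) + m * (t - s) := by
  refine exists_right_affine (S := Ioo 0 (G.len e) ∩ G.edgeMap e ⁻¹' {y, z})
    (F := fun t => f (G.edgeMap e t)) ?_
    (hf.continuous.comp (continuous_edgeMap e)).continuousOn (fun s hs hsS => ?_) hs
  · refine Finite.of_finite_image ((toFinite {y, z}).subset ?_)
      ((edgeMap_injOn e).mono inter_subset_left)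
    rintro _ ⟨t, ht, rfl⟩
    exact ht.2
  · have : G.edgeMap e s ∉ ({y, z} : Set G.Point) := fun h => hsS ⟨hs, h⟩
    simp only [mem_insert_iff, mem_singleton_iff, not_or] at this
    exact hf.locally_affine e s hs this.1 this.2

lemma left_affine (hf : G.IsVoltage z y f) (e : E) {s : ℝ} (hs : s ∈ Ioc 0 (G.len e)) :
    ∃ m : ℝ, ∀ᶠ t in 𝓝[≤] s, f (G.edgeMap e t) = f (G.edgeMap e s) + m * (t - s) := by
  refine exists_left_affine (S := Ioo 0 (G.len e) ∩ G.edgeMap e ⁻¹' {y, z})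
    (F := fun t => f (G.edgeMap e t)) ?_
    (hf.continuous.comp (continuous_edgeMap e)).continuousOn (fun s hs hsS => ?_) hs
  · refine Finite.of_finite_image ((toFinite {y, z}).subset ?_)
      ((edgeMap_injOn e).mono inter_subset_left)
    rintro _ ⟨t, ht, rfl⟩
    exact ht.2
  · have : G.edgeMap e s ∉ ({y, z} : Set G.Point) := fun h => hsS ⟨hs, h⟩
    simp only [mem_insert_iff, mem_singleton_iff, not_or] at this
    exact hf.locally_affine e s hs this.1 this.2

/-- The slopes of `f` and `k` jump by the same amount at each interior point, so the jumps cancel in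
`f - k`, at `y` and `z` too. -/
lemma sub_affine (hf : G.IsVoltage z y f) (hk : G.IsVoltage z y k) (e : E) :
    ∃ m : ℝ, (∀ t ∈ Icc 0 (G.len e), f (G.edgeMap e t) - k (G.edgeMap e t) =
        f (.vertex (G.src e)) - k (.vertex (G.src e)) + m * t) ∧
      derivWithin (fun t => f (G.edgeMap e t)) (Ici 0) 0
        - derivWithin (fun t => k (G.edgeMap e t)) (Ici 0) 0 = m ∧
      derivWithin (fun t => f (G.edgeMap e t)) (Iic (G.len e)) (G.len e)
        - derivWithin (fun t => k (G.edgeMap e t)) (Iic (G.len e)) (G.len e) = m := by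
  have hr : ∀ {s : ℝ} {m : ℝ} {F : ℝ → ℝ}, (∀ᶠ t in 𝓝[≥] s, F t = F s + m * (t - s)) →
      derivWithin F (Ici s) s = m := fun h =>
    (hasDerivWithinAt_affine h).derivWithin (uniqueDiffWithinAt_Ici _)
  have hl : ∀ {s : ℝ} {m : ℝ} {F : ℝ → ℝ}, (∀ᶠ t in 𝓝[≤] s, F t = F s + m * (t - s)) →
      derivWithin F (Iic s) s = m := fun h =>
    (hasDerivWithinAt_affine h).derivWithin (uniqueDiffWithinAt_Iic _)
  have hc : Continuous (fun t => f (G.edgeMap e t) - k (G.edgeMap e t)) :=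
    (hf.continuous.comp (continuous_edgeMap e)).sub (hk.continuous.comp (continuous_edgeMap e))
  obtain ⟨m, hm⟩ := exists_affine_of_locally_affine hc.continuousOn
    (fun s hs => by
      obtain ⟨m₁, h₁⟩ := hf.right_affine e ⟨hs.1.le, hs.2⟩
      obtain ⟨m₂, h₂⟩ := hf.left_affine e ⟨hs.1, hs.2.le⟩
      obtain ⟨m₃, h₃⟩ := hk.right_affine e ⟨hs.1.le, hs.2⟩
      obtain ⟨m₄, h₄⟩ := hk.left_affine e ⟨hs.1, hs.2.le⟩
      have h := (hf.point_mass (.inner e ⟨s, hs⟩)).trans (hk.point_mass (.inner e ⟨s, hs⟩)).symm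
      simp only [slopeSum] at h
      rw [hr h₁, hl h₂, hr h₃, hl h₄] at h
      refine ⟨m₁ - m₃, ?_⟩
      rw [← nhdsLE_sup_nhdsGE, eventually_sup]
      constructor
      · filter_upwards [h₂, h₄] with t e₂ e₄
        rw [e₂, e₄]
        linear_combination (t - s) * h
      · filter_upwards [h₁, h₃] with t e₁ e₃
        rw [e₁, e₃]
        ring)
  simp only [edgeMap_zero, sub_zero] at hm
  refine ⟨m, hm, ?_, ?_⟩
  · obtain ⟨m₁, h₁⟩ := hf.right_affine e (left_mem_Ico.2 (G.len_pos e))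
    obtain ⟨m₃, h₃⟩ := hk.right_affine e (left_mem_Ico.2 (G.len_pos e))
    rw [hr h₁, hr h₃]
    have hs : ∀ᶠ t in 𝓝[>] (0 : ℝ), m₁ - m₃ = m := by
      filter_upwards [h₁.filter_mono (nhdsWithin_mono _ Ioi_subset_Ici_self),
        h₃.filter_mono (nhdsWithin_mono _ Ioi_subset_Ici_self),
        Ioc_mem_nhdsGT (G.len_pos e)] with t e₁ e₃ ht
      have := hm t ⟨ht.1.le, ht.2⟩
      rw [e₁, e₃, edgeMap_zero] at this
      have : (m₁ - m₃ - m) * t = 0 := by linear_combination this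
      exact sub_eq_zero.1 ((mul_eq_zero.1 this).resolve_right ht.1.ne')
    exact hs.exists.choose_spec
  · obtain ⟨m₁, h₁⟩ := hf.left_affine e (right_mem_Ioc.2 (G.len_pos e))
    obtain ⟨m₃, h₃⟩ := hk.left_affine e (right_mem_Ioc.2 (G.len_pos e))
    rw [hl h₁, hl h₃]
    have hs : ∀ᶠ t in 𝓝[<] (G.len e), m₁ - m₃ = m := by
      filter_upwards [h₁.filter_mono (nhdsWithin_mono _ Iio_subset_Iic_self),
        h₃.filter_mono (nhdsWithin_mono _ Iio_subset_Iic_self),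
        Ico_mem_nhdsLT (G.len_pos e)] with t e₁ e₃ ht
      have h4 := hm t ⟨ht.1, ht.2.le⟩
      have h5 := hm _ ⟨(G.len_pos e).le, le_rfl⟩
      rw [e₁, e₃] at h4
      have : (m₁ - m₃ - m) * (t - G.len e) = 0 := by linear_combination h4 - h5
      exact sub_eq_zero.1 ((mul_eq_zero.1 this).resolve_right (sub_neg.2 ht.2).ne)
    exact hs.exists.choose_spec

/-- The difference is affine on edges and harmonic on vertices, hence constant, and it vanishes at
`z`. -/
lemma unique [Fintype V] (hG : G.Connected) (hf : G.IsVoltage z y f) (hk : G.IsVoltage z y k) :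
    f = k := by
  choose m hm h0 hL using hf.sub_affine hk
  have hend : ∀ e, (f (.vertex (G.src e)) - k (.vertex (G.src e))
      - (f (.vertex (G.tgt e)) - k (.vertex (G.tgt e)))) / G.len e = -m e := fun e => by
    have := hm e _ ⟨(G.len_pos e).le, le_rfl⟩
    rw [edgeMap_len] at this
    rw [this, div_eq_iff (G.len_pos e).ne']; ring
  have hlap : ∀ p, G.lap (fun v => f (.vertex v) - k (.vertex v)) p = 0 := fun p => by
    have h := (hf.point_mass (.vertex p)).trans (hk.point_mass (.vertex p)).symm
    simp only [slopeSum, neg_inj] at h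
    rw [← sub_eq_zero, ← Finset.sum_sub_distrib] at h
    rw [lap, ← neg_eq_zero, ← Finset.sum_neg_distrib]
    refine Eq.trans (Finset.sum_congr rfl fun e _ => ?_) h
    rw [hend]
    have e1 := h0 e
    have e2 := hL e
    split_ifs <;> linarith
  have hcon := hG.eq_of_lap_eq_zero hlap
  have hv : ∀ e, m e = 0 := fun e => by
    have h := hend e
    rw [hcon (G.src e) (G.tgt e)] at h
    simpa using h.symm
  obtain ⟨v⟩ := hG.1
  have hall : ∀ x, f x - k x = f (.vertex v) - k (.vertex v) := by
    refine Point.induction (fun p => hcon p v) fun e s hs => ?_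
    rw [hm e s (Ioo_subset_Icc_self hs), hv e, zero_mul, add_zero]
    exact hcon _ _
  have hz := hall z
  rw [hf.ground, hk.ground, sub_zero] at hz
  funext x
  have := hall x
  linarith

end IsVoltage

lemma IsVoltage.voltage_eq [Fintype V] (hG : G.Connected) (hf : G.IsVoltage z y f) (x : G.Point) :
    G.voltage z x y = f x := by
  have h : ∃ f, G.IsVoltage z y f := ⟨f, hf⟩
  rw [voltage, dif_pos h, h.choose_spec.unique hG hf]

end Voltage

end LengthGraph

lemma min_locally_affine {p s : ℝ} (h : s ≠ p) :
    ∃ c : ℝ, ∀ᶠ t in 𝓝 s, min t p = min s p + c * (t - s) := by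
  rcases h.lt_or_gt with h | h
  · refine ⟨1, ?_⟩
    filter_upwards [Iio_mem_nhds h] with t ht
    rw [min_eq_left (le_of_lt ht), min_eq_left h.le]; ring
  · refine ⟨0, ?_⟩
    filter_upwards [Ioi_mem_nhds h] with t ht
    rw [min_eq_right (le_of_lt ht), min_eq_right h.le]; ring

namespace LengthGraph

variable {V E : Type*} {G : LengthGraph V E}

/-! ### The Green kernel on the whole graph and the resistance function. -/

section Kernel

open Classical

/-- The extension of a function on the vertices that is affine on every edge. -/
def interp (φ : V → ℝ) : G.Point → ℝ
  | .vertex p => φ p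
  | .inner e s => (1 - s.1 / G.len e) * φ (G.src e) + s.1 / G.len e * φ (G.tgt e)

/-- The coordinate of a point in the interior of the edge `e`, and `0` for all other points. -/
def pos (e : E) : G.Point → ℝ
  | .vertex _ => 0
  | .inner e' s => if e' = e then s.1 else 0

lemma interp_edgeMap (φ : V → ℝ) (e : E) {t : ℝ} (ht : t ∈ Icc 0 (G.len e)) :
    interp φ (G.edgeMap e t) =
      (1 - t / G.len e) * φ (G.src e) + t / G.len e * φ (G.tgt e) := by
  rcases ht.1.eq_or_lt with rfl | h0
  · rw [edgeMap_zero]; simp [interp]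
  rcases ht.2.eq_or_lt with rfl | h1
  · rw [edgeMap_len, div_self (G.len_pos e).ne']; simp [interp]
  · rw [edgeMap_of_mem e ⟨h0, h1⟩]; rfl

lemma interp_comm (g : V → V → ℝ) (x y : G.Point) :
    interp (fun p => interp (g p) y) x = interp (fun q => interp (fun p => g p q) x) y := by
  cases x <;> cases y <;> simp only [interp]
  ring

lemma lap_interp [Fintype E] (g : V → V → ℝ) (y : G.Point) (p : V) :
    G.lap (fun v => interp (g v) y) p = interp (fun q => G.lap (fun v => g v q) p) y := by
  cases y with
  | vertex q => rfl
  | inner e s => simp only [interp]; rw [lap_add, lap_const_mul, lap_const_mul]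

lemma abs_interp_le {φ : V → ℝ} {B : ℝ} (h : ∀ p, |φ p| ≤ B) (x : G.Point) :
    |interp φ x| ≤ B := by
  cases x with
  | vertex p => exact h p
  | inner e s =>
    have h1 : 0 ≤ s.1 / G.len e := div_nonneg s.2.1.le (G.len_pos e).le
    have h2 : s.1 / G.len e ≤ 1 := (div_le_one (G.len_pos e)).2 s.2.2.le
    have ha := abs_le.1 (h (G.src e))
    have hb := abs_le.1 (h (G.tgt e))
    simp only [interp]
    rw [abs_le]
    constructor <;> nlinarith

lemma pos_edgeMap (e e' : E) {t : ℝ} (ht : t ∈ Ioo 0 (G.len e)) :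
    pos e' (G.edgeMap e t) = if e = e' then t else 0 := by
  rw [edgeMap_of_mem e ht]; rfl

lemma pos_mem (e : E) (y : G.Point) : pos e y ∈ Ico 0 (G.len e) := by
  cases y with
  | vertex p => exact left_mem_Ico.2 (G.len_pos e)
  | inner e' s =>
    simp only [pos]
    split_ifs with h
    · subst h; exact Ioo_subset_Ico_self s.2
    · exact left_mem_Ico.2 (G.len_pos e)

lemma eq_pos_iff (e : E) (y : G.Point) {s : ℝ} (hs : s ∈ Ioo 0 (G.len e)) :
    s = pos e y ↔ G.edgeMap e s = y := by
  constructor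
  · intro h
    cases y with
    | vertex p => exact absurd h hs.1.ne'
    | inner e' s' =>
      simp only [pos] at h
      split_ifs at h with he
      · subst he; subst h; exact edgeMap_of_mem _ hs
      · exact absurd h hs.1.ne'
  · rintro rfl
    rw [pos_edgeMap e e hs, if_pos rfl]

variable [Fintype E]

/-- The sum over the edges of the Green functions of the edges with Dirichlet boundary
conditions. -/
def hat (x y : G.Point) : ℝ := ∑ e, (min (pos e x) (pos e y) - pos e x * pos e y / G.len e)

lemma hat_comm (x y : G.Point) : hat x y = hat y x :=
  Finset.sum_congr rfl fun e _ => by rw [min_comm, mul_comm]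

lemma hat_vertex (p : V) (y : G.Point) : hat (.vertex p) y = 0 :=
  Finset.sum_eq_zero fun e _ => by
    have := (pos_mem e y).1
    simp only [show pos e (Point.vertex p : G.Point) = 0 from rfl, min_eq_left this]
    simp

/-- Only the term of `e` survives, as the other coordinates of the point are 0. The formula also
holds at both ends, where each side vanishes. -/
lemma hat_edgeMap (e : E) {t : ℝ} (ht : t ∈ Icc 0 (G.len e)) (y : G.Point) :
    hat (G.edgeMap e t) y = min t (pos e y) - t * pos e y / G.len e := by
  have hy := pos_mem e y
  rcases ht.1.eq_or_lt with rfl | h0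
  · rw [edgeMap_zero, hat_vertex, min_eq_left hy.1]; simp
  rcases ht.2.eq_or_lt with rfl | h1
  · rw [edgeMap_len, hat_vertex, min_eq_right hy.2.le, mul_div_cancel_left₀ _ (G.len_pos e).ne',
      sub_self]
  · rw [hat, Finset.sum_eq_single e]
    · rw [pos_edgeMap e e ⟨h0, h1⟩, if_pos rfl]
    · intro e' _ he
      rw [pos_edgeMap e e' ⟨h0, h1⟩, if_neg he.symm, min_eq_left (pos_mem e' y).1]; simp
    · simp

lemma abs_hat_le (x y : G.Point) : |hat x y| ≤ ∑ e, G.len e := by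
  refine (Finset.abs_sum_le_sum_abs _ _).trans (Finset.sum_le_sum fun e _ => ?_)
  have hx := pos_mem e x
  have hy := pos_mem e y
  have h1 : pos e x * pos e y / G.len e ≤ min (pos e x) (pos e y) := by
    rw [div_le_iff₀ (G.len_pos e)]
    rcases min_choice (pos e x) (pos e y) with h | h <;> rw [h] <;> nlinarith [hx.1, hy.1, hx.2, hy.2]
  have h2 : 0 ≤ pos e x * pos e y / G.len e :=
    div_nonneg (mul_nonneg hx.1 hy.1) (G.len_pos e).le
  rw [abs_of_nonneg (sub_nonneg.2 h1)]
  linarith [min_le_left (pos e x) (pos e y), hx.2]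

/-- The Green kernel on the metrized graph extending the kernel `g` on the vertices. -/
def green (g : V → V → ℝ) (x y : G.Point) : ℝ :=
  interp (fun p => interp (g p) y) x + hat x y

variable {z₀ : V} {g : V → V → ℝ}

lemma green_vertex (p : V) (y : G.Point) : green g (.vertex p) y = interp (g p) y := by
  rw [green, hat_vertex, add_zero]; rfl

lemma IsGreen.green_comm (hg : G.IsGreen z₀ g) (x y : G.Point) : green g x y = green g y x := by
  rw [green, green, hat_comm, interp_comm]
  simp only [fun p q => hg.symm p q]

lemma green_edgeMap (e : E) {t : ℝ} (ht : t ∈ Icc 0 (G.len e)) (y : G.Point) :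
    green g (G.edgeMap e t) y = interp (g (G.src e)) y +
      ((interp (g (G.tgt e)) y - interp (g (G.src e)) y) / G.len e - pos e y / G.len e) * t
      + min t (pos e y) := by
  rw [green, interp_edgeMap _ e ht, hat_edgeMap e ht]
  ring

lemma hat_self_edgeMap (e : E) {t : ℝ} (ht : t ∈ Icc 0 (G.len e)) :
    hat (G.edgeMap e t) (G.edgeMap e t) = t * (G.len e - t) / G.len e := by
  have hL := (G.len_pos e).ne'
  rcases ht.1.eq_or_lt with rfl | h0
  · rw [edgeMap_zero, hat_vertex]; simp
  rcases ht.2.eq_or_lt with rfl | h1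
  · rw [edgeMap_len, hat_vertex]; simp
  · rw [hat_edgeMap e ht, pos_edgeMap e e ⟨h0, h1⟩, if_pos rfl, min_self]
    field_simp

lemma green_self_edgeMap (e : E) {t : ℝ} (ht : t ∈ Icc 0 (G.len e)) :
    green g (G.edgeMap e t) (G.edgeMap e t) =
      (1 - t / G.len e) *
        ((1 - t / G.len e) * g (G.src e) (G.src e) + t / G.len e * g (G.src e) (G.tgt e)) +
      t / G.len e *
        ((1 - t / G.len e) * g (G.tgt e) (G.src e) + t / G.len e * g (G.tgt e) (G.tgt e)) +
      t * (G.len e - t) / G.len e := by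
  rw [green, hat_self_edgeMap e ht, interp_edgeMap _ e ht, interp_edgeMap _ e ht,
    interp_edgeMap _ e ht]

lemma continuous_green_self : Continuous fun x : G.Point => green g x x := by
  refine continuous_of_edges fun e => ?_
  refine ContinuousOn.congr (f := fun t => (1 - t / G.len e) *
      ((1 - t / G.len e) * g (G.src e) (G.src e) + t / G.len e * g (G.src e) (G.tgt e)) +
    t / G.len e *
      ((1 - t / G.len e) * g (G.tgt e) (G.src e) + t / G.len e * g (G.tgt e) (G.tgt e)) +
    t * (G.len e - t) / G.len e) (by fun_prop) fun t ht => green_self_edgeMap e ht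

lemma continuous_green (y : G.Point) : Continuous fun x => green g x y := by
  refine continuous_of_edges fun e => ?_
  refine ContinuousOn.congr (f := fun t => interp (g (G.src e)) y +
      ((interp (g (G.tgt e)) y - interp (g (G.src e)) y) / G.len e - pos e y / G.len e) * t
      + min t (pos e y)) ?_ fun t ht => green_edgeMap e ht y
  fun_prop

lemma green_right (e : E) {s : ℝ} (hs : s ∈ Ico 0 (G.len e)) (y : G.Point) :
    HasDerivWithinAt (fun t => green g (G.edgeMap e t) y)
      ((interp (g (G.tgt e)) y - interp (g (G.src e)) y) / G.len e - pos e y / G.len e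
        + if s < pos e y then 1 else 0) (Ici s) s := by
  have h := ((((hasDerivAt_id s).const_mul ((interp (g (G.tgt e)) y - interp (g (G.src e)) y)
    / G.len e - pos e y / G.len e)).const_add (interp (g (G.src e)) y)).hasDerivWithinAt
    (s := Ici s)).add (hasDerivWithinAt_min_Ici (pos e y) s)
  rw [mul_one] at h
  refine h.congr_of_eventuallyEq ?_ (green_edgeMap e ⟨hs.1, hs.2.le⟩ y)
  filter_upwards [Icc_mem_nhdsGE hs.2] with t ht
  exact green_edgeMap e ⟨hs.1.trans ht.1, ht.2⟩ y

lemma green_left (e : E) {s : ℝ} (hs : s ∈ Ioc 0 (G.len e)) (y : G.Point) :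
    HasDerivWithinAt (fun t => green g (G.edgeMap e t) y)
      ((interp (g (G.tgt e)) y - interp (g (G.src e)) y) / G.len e - pos e y / G.len e
        + if s ≤ pos e y then 1 else 0) (Iic s) s := by
  have h := ((((hasDerivAt_id s).const_mul ((interp (g (G.tgt e)) y - interp (g (G.src e)) y)
    / G.len e - pos e y / G.len e)).const_add (interp (g (G.src e)) y)).hasDerivWithinAt
    (s := Iic s)).add (hasDerivWithinAt_min_Iic (pos e y) s)
  rw [mul_one] at h
  refine h.congr_of_eventuallyEq ?_ (green_edgeMap e ⟨hs.1.le, hs.2⟩ y)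
  filter_upwards [Icc_mem_nhdsLE hs.1] with t ht
  exact green_edgeMap e ⟨ht.1, ht.2.trans hs.2⟩ y

/-- The left side is the sum of outward slopes of `hat · y` at `p`. For `y` inside an edge these
slopes, `1 - s/L` and `s/L`, are the interpolation weights, so `hat` cancels the mass that
interpolation spreads to the ends. -/
lemma interp_single_eq (y : G.Point) (p : V) :
    ∑ e, ((if G.src e = p then (if 0 < pos e y then 1 else 0) - pos e y / G.len e else 0)
      + (if G.tgt e = p then pos e y / G.len e else 0)) =
    interp (fun q => if p = q then 1 else 0) y - if Point.vertex p = y then 1 else 0 := by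
  cases y with
  | vertex q => simp [pos, interp]
  | inner e s =>
    rw [Finset.sum_eq_single e]
    · simp only [pos, if_true, s.2.1, interp, reduceCtorEq, if_false, eq_comm (a := p)]
      split_ifs <;> ring
    · intro e' _ he
      simp [pos, he.symm]
    · simp

lemma IsGreen.slopeSum_green (hg : G.IsGreen z₀ g) (x y : G.Point) :
    -G.slopeSum (fun x => green g x y) x =
      (if x = y then 1 else 0) - (if x = .vertex z₀ then 1 else 0) := by
  cases x with
  | inner e s =>
    simp only [slopeSum]
    rw [(green_right e (Ioo_subset_Ico_self s.2) y).derivWithin (uniqueDiffWithinAt_Ici _),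
      (green_left e (Ioo_subset_Ioc_self s.2) y).derivWithin (uniqueDiffWithinAt_Iic _)]
    have h := eq_pos_iff e y s.2
    rw [edgeMap_of_mem e s.2] at h
    simp only [← h, reduceCtorEq, if_false]
    rcases lt_trichotomy s.1 (pos e y) with h1 | h1 | h1
    · rw [if_pos h1, if_pos h1.le, if_neg h1.ne]; ring
    · rw [if_neg h1.not_lt, if_pos h1.le, if_pos h1]; ring
    · rw [if_neg h1.le.not_gt, if_neg h1.not_ge, if_neg h1.ne']; ring
  | vertex p =>
    have h1 := interp_single_eq y p
    -- Interpolation in `y` commutes with the Laplacian in the vertex variable and preserves the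
    -- constant part `-δ_{z₀}`.
    have h2 : G.lap (fun v => interp (g v) y) p =
        interp (fun q => if p = q then 1 else 0) y - (if p = z₀ then 1 else 0) := by
      rw [lap_interp]
      simp only [hg.lap_eq]
      cases y <;> simp only [interp]
      ring
    simp only [slopeSum, Point.vertex.injEq]
    have : ∀ e, ((if G.src e = p then
          derivWithin (fun t => green g (G.edgeMap e t) y) (Ici 0) 0 else 0)
        + (if G.tgt e = p then
          -derivWithin (fun t => green g (G.edgeMap e t) y) (Iic (G.len e)) (G.len e) else 0)) =
        ((if G.src e = p then (if 0 < pos e y then 1 else 0) - pos e y / G.len e else 0)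
          + (if G.tgt e = p then pos e y / G.len e else 0)) -
        (interp (g (G.src e)) y - interp (g (G.tgt e)) y) / G.len e *
          ((if G.src e = p then 1 else 0) - (if G.tgt e = p then 1 else 0)) := fun e => by
      rw [(green_right e (left_mem_Ico.2 (G.len_pos e)) y).derivWithin
          (uniqueDiffWithinAt_Ici _),
        (green_left e (right_mem_Ioc.2 (G.len_pos e)) y).derivWithin (uniqueDiffWithinAt_Iic _),
        if_neg (pos_mem e y).2.not_ge]
      split_ifs <;> ring
    rw [Finset.sum_congr rfl fun e _ => this e, Finset.sum_sub_distrib, h1]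
    unfold lap at h2
    rw [h2]
    ring

lemma IsGreen.isVoltage (hg : G.IsGreen z₀ g) (z y : G.Point) :
    G.IsVoltage z y fun x => green g x y - green g x z - (green g z y - green g z z) where
  continuous := ((continuous_green y).sub (continuous_green z)).sub continuous_const
  ground := by ring
  locally_affine e s hs hy hz := by
    obtain ⟨c, hc⟩ := min_locally_affine (mt (eq_pos_iff e y hs).1 hy)
    obtain ⟨d, hd⟩ := min_locally_affine (mt (eq_pos_iff e z hs).1 hz)
    refine ⟨((interp (g (G.tgt e)) y - interp (g (G.src e)) y) / G.len e - pos e y / G.len e)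
      - ((interp (g (G.tgt e)) z - interp (g (G.src e)) z) / G.len e - pos e z / G.len e)
      + c - d, ?_⟩
    filter_upwards [hc, hd, Ioo_mem_nhds hs.1 hs.2] with t h1 h2 ht
    have ht' := Ioo_subset_Icc_self ht
    have hs' := Ioo_subset_Icc_self hs
    rw [green_edgeMap e ht', green_edgeMap e ht', green_edgeMap e hs', green_edgeMap e hs', h1, h2]
    ring
  point_mass x := by
    have hr : ∀ e, ∀ s ∈ Ico 0 (G.len e), derivWithin (fun t => green g (G.edgeMap e t) y
        - green g (G.edgeMap e t) z - (green g z y - green g z z)) (Ici s) s =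
        derivWithin (fun t => green g (G.edgeMap e t) y) (Ici s) s
        - derivWithin (fun t => green g (G.edgeMap e t) z) (Ici s) s := fun e s hs => by
      have h1 := green_right (g := g) e hs y
      have h2 := green_right (g := g) e hs z
      rw [((h1.fun_sub h2).sub_const _).derivWithin (uniqueDiffWithinAt_Ici _),
        h1.derivWithin (uniqueDiffWithinAt_Ici _), h2.derivWithin (uniqueDiffWithinAt_Ici _)]
    have hl : ∀ e, ∀ s ∈ Ioc 0 (G.len e), derivWithin (fun t => green g (G.edgeMap e t) y
        - green g (G.edgeMap e t) z - (green g z y - green g z z)) (Iic s) s =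
        derivWithin (fun t => green g (G.edgeMap e t) y) (Iic s) s
        - derivWithin (fun t => green g (G.edgeMap e t) z) (Iic s) s := fun e s hs => by
      have h1 := green_left (g := g) e hs y
      have h2 := green_left (g := g) e hs z
      rw [((h1.fun_sub h2).sub_const _).derivWithin (uniqueDiffWithinAt_Iic _),
        h1.derivWithin (uniqueDiffWithinAt_Iic _), h2.derivWithin (uniqueDiffWithinAt_Iic _)]
    have key : G.slopeSum (fun x => green g x y - green g x z - (green g z y - green g z z)) x =
        G.slopeSum (fun x => green g x y) x - G.slopeSum (fun x => green g x z) x := by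
      cases x with
      | inner e s =>
        simp only [slopeSum]
        rw [hr e s (Ioo_subset_Ico_self s.2), hl e s (Ioo_subset_Ioc_self s.2)]
        ring
      | vertex p =>
        simp only [slopeSum]
        rw [← Finset.sum_sub_distrib]
        refine Finset.sum_congr rfl fun e _ => ?_
        rw [hr e 0 (left_mem_Ico.2 (G.len_pos e)), hl e _ (right_mem_Ioc.2 (G.len_pos e))]
        split_ifs <;> ring
    have hy := hg.slopeSum_green x y
    have hz := hg.slopeSum_green x z
    rw [key]
    linear_combination hy - hz

variable [Fintype V]

lemma IsGreen.resistance_eq_green (hG : G.Connected) (hg : G.IsGreen z₀ g) (x y : G.Point) :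
    G.resistance x y = green g x x - 2 * green g x y + green g y y := by
  rw [resistance, (hg.isVoltage y x).voltage_eq hG, hg.green_comm y x]
  ring

lemma IsGreen.resistance_vertex (hG : G.Connected) (hg : G.IsGreen z₀ g) (p q : V) :
    G.resistance (.vertex p) (.vertex q) = g p p - 2 * g p q + g q q := by
  simp only [hg.resistance_eq_green hG, green_vertex, interp]

lemma Connected.resistance_comm (hG : G.Connected) (x y : G.Point) :
    G.resistance x y = G.resistance y x := by
  obtain ⟨z, g, hg⟩ := hG.exists_isGreen
  rw [hg.resistance_eq_green hG, hg.resistance_eq_green hG, hg.green_comm x y]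
  ring

lemma Connected.continuous_resistance (hG : G.Connected) (x : G.Point) :
    Continuous fun y => G.resistance x y := by
  obtain ⟨z, g, hg⟩ := hG.exists_isGreen
  simp only [hg.resistance_eq_green hG, hg.green_comm x]
  exact (continuous_const.sub ((continuous_green x).const_mul 2)).add continuous_green_self

lemma Connected.exists_resistance_le (hG : G.Connected) :
    ∃ C, ∀ x y, |G.resistance x y| ≤ C := by
  obtain ⟨z, g, hg⟩ := hG.exists_isGreen
  have hgb : ∀ p q, |g p q| ≤ ∑ p, ∑ q, |g p q| := fun p q =>
    (Finset.single_le_sum (f := fun q => |g p q|) (fun _ _ => abs_nonneg _)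
      (Finset.mem_univ q)).trans
    (Finset.single_le_sum (f := fun p => ∑ q, |g p q|)
      (fun _ _ => Finset.sum_nonneg fun _ _ => abs_nonneg _) (Finset.mem_univ p))
  have hb : ∀ x y : G.Point, |green g x y| ≤ (∑ p, ∑ q, |g p q|) + ∑ e, G.len e := fun x y =>
    (abs_add_le _ _).trans (add_le_add (abs_interp_le (fun p => abs_interp_le (hgb p) y) x)
      (abs_hat_le x y))
  refine ⟨4 * ((∑ p, ∑ q, |g p q|) + ∑ e, G.len e), fun x y => ?_⟩
  rw [hg.resistance_eq_green hG, abs_le]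
  have h1 := abs_le.1 (hb x x)
  have h2 := abs_le.1 (hb x y)
  have h3 := abs_le.1 (hb y y)
  constructor <;> linarith

end Kernel

end LengthGraph

namespace LengthGraph

variable {V E : Type*} {G : LengthGraph V E}

/-! ### Deleting an edge: the density of the canonical measure. -/

section Deletion

open Classical

lemma lap_eq_lap_deleteEdge_add [Fintype E] (e : E) [Fintype {e' : E // e' ≠ e}] (φ : V → ℝ)
    (p : V) :
    G.lap φ p = (G.deleteEdge e).lap φ p + (φ (G.src e) - φ (G.tgt e)) / G.len e *
      ((if p = G.src e then 1 else 0) - (if p = G.tgt e then 1 else 0)) := by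
  rw [lap, Fintype.sum_eq_add_sum_subtype_ne _ e, add_comm, lap]
  simp only [eq_comm (a := p)]
  congr 1
  exact Finset.sum_congr (by ext; simp) fun _ _ => rfl

variable [Fintype V]

/-- The resistance is the energy of the unit-current potential `g · p - g · q`. -/
lemma Connected.resistance_nonneg [Fintype E] (hG : G.Connected) (p q : V) :
    0 ≤ G.resistance (.vertex p) (.vertex q) := by
  obtain ⟨z, g, hg⟩ := hG.exists_isGreen
  have hl : ∀ v, G.lap (fun u => g u p + (-1) * g u q) v =
      (if v = p then 1 else 0) - (if v = q then 1 else 0) := fun v => by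
    rw [lap_add, lap_const_mul, hg.lap_eq, hg.lap_eq]; ring
  have h := G.sum_mul_lap (fun u => g u p + (-1) * g u q) (fun u => g u p + (-1) * g u q)
  simp only [hl, mul_sub, mul_ite, mul_one, mul_zero, Finset.sum_sub_distrib, Finset.sum_ite_eq',
    Finset.mem_univ, if_true] at h
  rw [hg.resistance_vertex hG]
  have h0 := Finset.sum_nonneg fun e (_ : e ∈ Finset.univ) =>
    div_nonneg (mul_self_nonneg (g (G.src e) p + -1 * g (G.src e) q
      - (g (G.tgt e) p + -1 * g (G.tgt e) q))) (G.len_pos e).le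
  simp only [mul_sub] at h0
  have := hg.symm p q
  linarith

lemma Connected.inv_len_add_deletedResistance [Fintype E] (hG : G.Connected) (e : E) :
    ∃ ρ : ℝ, 0 ≤ ρ ∧ (ENNReal.ofReal (G.len e) + G.deletedResistance e)⁻¹ = ENNReal.ofReal ρ ∧
      ρ = (1 - G.resistance (.vertex (G.src e)) (.vertex (G.tgt e)) / G.len e) / G.len e := by
  obtain ⟨z, g, hg⟩ := hG.exists_isGreen
  have hL := G.len_pos e
  rw [hg.resistance_vertex hG]
  by_cases hc : (G.deleteEdge e).Connected
  · rw [deletedResistance, if_pos hc]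
    set R := (G.deleteEdge e).resistance (.vertex (G.src e)) (.vertex (G.tgt e)) with hR
    have hR0 : 0 ≤ R := hc.resistance_nonneg _ _
    obtain ⟨z', g', hg'⟩ := hc.exists_isGreen
    rw [hg'.resistance_vertex hc] at hR
    -- Parallel law: a unit-current potential of the deleted graph drops by `R` across `e`, so
    -- restoring `e` adds current `R / L` to the unit current.
    have hr := hg.resistance_eq hG (f := fun v => g' v (G.src e) + (-1) * g' v (G.tgt e))
      (a := G.src e) (b := G.tgt e) (c := 1 + R / G.len e) fun p => by
        rw [lap_eq_lap_deleteEdge_add e, lap_add, lap_const_mul, hg'.lap_eq, hg'.lap_eq, hR,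
          hg'.symm (G.tgt e) (G.src e)]
        ring
    rw [hg'.symm (G.tgt e) (G.src e)] at hr
    refine ⟨(G.len e + R)⁻¹, by positivity, ?_, ?_⟩
    · rw [← ENNReal.ofReal_add hL.le hR0, ENNReal.ofReal_inv_of_pos (by positivity)]
    · have hr' : g (G.src e) (G.src e) - 2 * g (G.src e) (G.tgt e) + g (G.tgt e) (G.tgt e)
          = R * G.len e / (G.len e + R) := by
        have : G.len e + R ≠ 0 := by positivity
        field_simp at hr ⊢
        linear_combination hr - G.len e * hR
      rw [hr']
      have : G.len e + R ≠ 0 := by positivity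
      field_simp
      ring
  · rw [deletedResistance, if_neg hc]
    -- For a bridge, the indicator of the component of `src e` in the deleted graph changes only
    -- across `e`: drop 1, current `1 / L`, hence resistance `L` and density 0.
    let A : V → Prop := fun v =>
      Relation.EqvGen (fun a b => ∃ e', (G.deleteEdge e).src e' = a ∧ (G.deleteEdge e).tgt e' = b)
        (G.src e) v
    have hA : ¬ A (G.tgt e) := fun h => hc ⟨hG.1, fun p q => by
      induction hG.2 p q with
      | rel _ _ h' =>
        obtain ⟨e', rfl, rfl⟩ := h'
        by_cases he : e' = e
        · subst he; exact h
        · exact .rel _ _ ⟨⟨e', he⟩, rfl, rfl⟩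
      | refl _ => exact .refl _
      | symm _ _ _ ih => exact .symm _ _ ih
      | trans _ _ _ _ _ ih₁ ih₂ => exact .trans _ _ _ ih₁ ih₂⟩
    have hA' : A (G.src e) := .refl _
    have hr := hg.resistance_eq hG (f := fun v => if A v then 1 else 0)
      (a := G.src e) (b := G.tgt e) (c := 1 / G.len e) fun p => by
        rw [lap_eq_lap_deleteEdge_add e, if_pos hA', if_neg hA, lap, Finset.sum_eq_zero]
        · ring
        · intro e' _
          have : A ((G.deleteEdge e).src e') ↔ A ((G.deleteEdge e).tgt e') :=
            ⟨fun h => .trans _ _ _ h (.rel _ _ ⟨e', rfl, rfl⟩),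
              fun h => .trans _ _ _ h (.symm _ _ (.rel _ _ ⟨e', rfl, rfl⟩))⟩
          simp only [this, sub_self, zero_div, zero_mul]
    rw [if_pos hA', if_neg hA] at hr
    refine ⟨0, le_rfl, by simp, ?_⟩
    have hr' : g (G.src e) (G.src e) - 2 * g (G.src e) (G.tgt e) + g (G.tgt e) (G.tgt e)
        = G.len e := by
      field_simp at hr
      linear_combination hr
    rw [hr', div_self hL.ne']
    simp

end Deletion

end LengthGraph

lemma integral_affine (α β a b : ℝ) :
    ∫ s in a..b, (α + s * β) = α * (b - a) + β * (b ^ 2 - a ^ 2) / 2 := by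
  rw [intervalIntegral.integral_add (by simp)
    (Continuous.intervalIntegrable (by fun_prop) _ _), intervalIntegral.integral_mul_const,
    integral_id, intervalIntegral.integral_const, smul_eq_mul]
  ring

lemma integral_min_sub {p l : ℝ} (h0 : 0 ≤ p) (hl : p ≤ l) (hl0 : 0 < l) :
    ∫ s in (0 : ℝ)..l, (min s p - s * p / l) = p * (l - p) / 2 := by
  have hc : Continuous fun s : ℝ => min s p - s * p / l := by fun_prop
  rw [← intervalIntegral.integral_add_adjacent_intervals (hc.intervalIntegrable 0 p)
    (hc.intervalIntegrable p l)]
  have h1 : ∫ s in (0 : ℝ)..p, (min s p - s * p / l) = ∫ s in (0 : ℝ)..p, 0 + s * (1 - p / l) := by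
    refine intervalIntegral.integral_congr fun s hs => ?_
    rw [uIcc_of_le h0] at hs
    rw [min_eq_left hs.2]; ring
  have h2 : ∫ s in p..l, (min s p - s * p / l) = ∫ s in p..l, (p + s * (-(p / l))) := by
    refine intervalIntegral.integral_congr fun s hs => ?_
    rw [uIcc_of_le hl] at hs
    rw [min_eq_right hs.1]; ring
  rw [h1, h2, integral_affine, integral_affine]
  field_simp
  ring

namespace LengthGraph

variable {V E : Type*} {G : LengthGraph V E}

/-! ### Integration against the explicit canonical measure. -/

section CanonicalFunctional

open Classical

lemma continuous_interp (φ : V → ℝ) : Continuous (interp φ : G.Point → ℝ) :=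
  continuous_of_edges fun e => ContinuousOn.congr
    (f := fun t => (1 - t / G.len e) * φ (G.src e) + t / G.len e * φ (G.tgt e)) (by fun_prop)
    fun _ ht => interp_edgeMap φ e ht

variable [Fintype E]

lemma continuous_hat (x : G.Point) : Continuous (hat x) :=
  continuous_of_edges fun e => ContinuousOn.congr
    (f := fun t => min t (pos e x) - t * pos e x / G.len e) (by fun_prop)
    fun t ht => by rw [hat_comm, hat_edgeMap e ht]

lemma valence_eq_sum (G : LengthGraph V E) (p : V) :
    (G.valence p : ℝ) = ∑ e, ((if G.src e = p then 1 else 0) + (if G.tgt e = p then 1 else 0)) := by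
  rw [valence, Nat.card_eq_fintype_card, Nat.card_eq_fintype_card, Fintype.card_subtype,
    Fintype.card_subtype, Finset.sum_add_distrib]
  simp

variable [Fintype V]

lemma sum_valence_mul (G : LengthGraph V E) (φ : V → ℝ) :
    ∑ p, (G.valence p : ℝ) * φ p = ∑ e, (φ (G.src e) + φ (G.tgt e)) := by
  simp only [valence_eq_sum, Finset.sum_mul, add_mul, ite_mul, one_mul, zero_mul]
  rw [Finset.sum_comm]
  simp [Finset.sum_add_distrib]

/-- The density of the canonical measure on the edge `e`, that is `1 / (L_e + R_e)`. -/
def canDensity (G : LengthGraph V E) (e : E) : ℝ :=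
  (1 - G.resistance (.vertex (G.src e)) (.vertex (G.tgt e)) / G.len e) / G.len e

/-- Integration of a continuous function against the canonical measure. -/
def canInt (G : LengthGraph V E) (f : G.Point → ℝ) : ℝ :=
  ∑ p, (1 - (G.valence p : ℝ) / 2) * f (.vertex p)
    + ∑ e, G.canDensity e * ∫ s in (0 : ℝ)..G.len e, f (G.edgeMap e s)

lemma canInt_add {f k : G.Point → ℝ} (hf : Continuous f) (hk : Continuous k) :
    G.canInt (fun x => f x + k x) = G.canInt f + G.canInt k := by
  have : ∀ e, ∫ s in (0 : ℝ)..G.len e, (f (G.edgeMap e s) + k (G.edgeMap e s)) =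
      (∫ s in (0 : ℝ)..G.len e, f (G.edgeMap e s)) + ∫ s in (0 : ℝ)..G.len e, k (G.edgeMap e s) :=
    fun e => intervalIntegral.integral_add
      ((hf.comp (continuous_edgeMap e)).intervalIntegrable _ _)
      ((hk.comp (continuous_edgeMap e)).intervalIntegrable _ _)
  simp only [canInt, this, mul_add, Finset.sum_add_distrib]
  ring

lemma canInt_const_mul (c : ℝ) (f : G.Point → ℝ) :
    G.canInt (fun x => c * f x) = c * G.canInt f := by
  simp only [canInt, intervalIntegral.integral_const_mul, mul_add, Finset.mul_sum]
  congr 1 <;> exact Finset.sum_congr rfl fun _ _ => by ring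

variable {z₀ : V} {g : V → V → ℝ}

lemma IsGreen.canDensity_eq (hG : G.Connected) (hg : G.IsGreen z₀ g) (e : E) :
    G.canDensity e = (1 - (g (G.src e) (G.src e) - 2 * g (G.src e) (G.tgt e)
      + g (G.tgt e) (G.tgt e)) / G.len e) / G.len e := by
  rw [canDensity, hg.resistance_vertex hG]

/-- An affine function integrates over an edge to `L` times the mean of its end values, so each end
receives mass `(1 - r_e/L)/2`; with the vertex mass `1 - υ/2` this adds up to `mass`. -/
lemma IsGreen.canInt_interp (hG : G.Connected) (hg : G.IsGreen z₀ g) (φ : V → ℝ) :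
    G.canInt (interp φ) = ∑ p, IsGreen.mass G g p * φ p := by
  have h1 : ∀ e, ∫ s in (0 : ℝ)..G.len e, interp φ (G.edgeMap e s) =
      G.len e * (φ (G.src e) + φ (G.tgt e)) / 2 := fun e => by
    have hL := G.len_pos e
    have : ∫ s in (0 : ℝ)..G.len e, interp φ (G.edgeMap e s) =
        ∫ s in (0 : ℝ)..G.len e, (φ (G.src e) + s * ((φ (G.tgt e) - φ (G.src e)) / G.len e)) := by
      refine intervalIntegral.integral_congr fun s hs => ?_
      rw [uIcc_of_le hL.le] at hs
      rw [interp_edgeMap φ e hs]; ring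
    rw [this, integral_affine]
    field_simp
    ring
  have h2 : ∑ p, IsGreen.mass G g p * φ p = ∑ p, φ p - 1 / 2 *
      ∑ e, (g (G.src e) (G.src e) - 2 * g (G.src e) (G.tgt e) + g (G.tgt e) (G.tgt e)) / G.len e
        * (φ (G.src e) + φ (G.tgt e)) := by
    simp only [IsGreen.mass, sub_mul, one_mul, Finset.sum_sub_distrib, mul_assoc,
      ← Finset.mul_sum, Finset.sum_mul]
    rw [Finset.sum_comm]
    congr 2
    refine Finset.sum_congr rfl fun e _ => ?_
    simp only [← Finset.mul_sum, add_mul, ite_mul, one_mul, zero_mul,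
      Finset.sum_add_distrib, Finset.sum_ite_eq, Finset.mem_univ, if_true]
  have h3 : ∑ p, (1 - (G.valence p : ℝ) / 2) * φ p =
      ∑ p, φ p - 1 / 2 * ∑ e, (φ (G.src e) + φ (G.tgt e)) := by
    rw [← sum_valence_mul, Finset.mul_sum, ← Finset.sum_sub_distrib]
    exact Finset.sum_congr rfl fun _ _ => by ring
  have h4 : canInt G (interp φ) = ∑ p, (1 - (G.valence p : ℝ) / 2) * φ p +
      ∑ e, G.canDensity e * (G.len e * (φ (G.src e) + φ (G.tgt e)) / 2) := by
    simp only [canInt, h1]; rfl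
  rw [h4, h2, h3, Finset.mul_sum, Finset.mul_sum, sub_add, ← Finset.sum_sub_distrib]
  congr 1
  refine Finset.sum_congr rfl fun e _ => ?_
  have hL := (G.len_pos e).ne'
  rw [hg.canDensity_eq hG]
  field_simp
  ring

lemma Connected.canInt_const (hG : G.Connected) (c : ℝ) : G.canInt (fun _ => c) = c := by
  obtain ⟨z, g, hg⟩ := hG.exists_isGreen
  have h : (fun _ : G.Point => c) = interp fun _ => c := by
    funext x
    cases x <;> simp only [interp]
    ring
  rw [h, hg.canInt_interp hG, ← Finset.sum_mul, hg.sum_mass, one_mul]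

lemma canInt_hat (x : G.Point) :
    G.canInt (hat x) = ∑ e, G.canDensity e * (pos e x * (G.len e - pos e x) / 2) := by
  have h : ∀ e, ∫ s in (0 : ℝ)..G.len e, hat x (G.edgeMap e s) =
      pos e x * (G.len e - pos e x) / 2 := fun e => by
    rw [← integral_min_sub (pos_mem e x).1 (pos_mem e x).2.le (G.len_pos e)]
    refine intervalIntegral.integral_congr fun s hs => ?_
    rw [uIcc_of_le (G.len_pos e).le] at hs
    rw [hat_comm, hat_edgeMap e hs]
  simp only [canInt, h]
  rw [Finset.sum_eq_zero fun p _ => by rw [hat_comm, hat_vertex, mul_zero], zero_add]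

lemma IsGreen.canInt_green (hG : G.Connected) (hg : G.IsGreen z₀ g) (x : G.Point) :
    G.canInt (green g x) = interp (fun p => ∑ v, IsGreen.mass G g v * g p v) x
      + G.canInt (hat x) := by
  have h : green g x = fun y => interp (fun q => interp (fun p => g p q) x) y + hat x y := by
    funext y; rw [green, interp_comm]
  rw [h, canInt_add (continuous_interp _) (continuous_hat x), hg.canInt_interp hG]
  congr 1
  cases x with
  | vertex p => rfl
  | inner e s =>
    simp only [interp, Finset.mul_sum, ← Finset.sum_add_distrib]
    exact Finset.sum_congr rfl fun _ _ => by ring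

/-- At vertices this is `diag_sub_const`. At the point `uL` of an edge, both `green x x` and `2 ∫
green x dμ` exceed the affine interpolation of their end values by `u(1 - u)(L - r_e)`; this is what
forces the density `(1 - r_e/L)/L`. -/
lemma IsGreen.green_self_sub_canInt (hG : G.Connected) (hg : G.IsGreen z₀ g) (x y : G.Point) :
    green g x x - 2 * G.canInt (green g x) = green g y y - 2 * G.canInt (green g y) := by
  have hv : ∀ p, green g (.vertex p : G.Point) (.vertex p) - 2 * G.canInt (green g (.vertex p)) =
      g p p - 2 * ∑ v, IsGreen.mass G g v * g p v := fun p => by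
    rw [hg.canInt_green hG, green_vertex, canInt_hat]
    simp [pos, interp]
  have key : ∀ x : G.Point, green g x x - 2 * G.canInt (green g x) =
      g z₀ z₀ - 2 * ∑ v, IsGreen.mass G g v * g z₀ v := by
    refine Point.induction (fun p => ?_) fun e s hs => ?_
    · rw [hv, hg.diag_sub_const hG]
    · have ha := hg.diag_sub_const hG (G.src e) z₀
      have hb := hg.diag_sub_const hG (G.tgt e) z₀
      have hs' := Ioo_subset_Icc_self hs
      rw [hg.canInt_green hG, green_self_edgeMap e hs', interp_edgeMap _ e hs', canInt_hat,
        Finset.sum_eq_single e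
          (fun e' _ he => by rw [pos_edgeMap e e' hs, if_neg he.symm]; simp) (by simp),
        pos_edgeMap e e hs, if_pos rfl, hg.canDensity_eq hG, hg.symm (G.tgt e) (G.src e)]
      have hL := (G.len_pos e).ne'
      generalize ∑ v, IsGreen.mass G g v * g (G.src e) v = A at *
      generalize ∑ v, IsGreen.mass G g v * g (G.tgt e) v = B at *
      obtain ⟨u, rfl⟩ : ∃ u, s = u * G.len e := ⟨s / G.len e, by field_simp⟩
      rw [mul_div_cancel_right₀ _ hL]
      field_simp
      linear_combination (1 - u) * ha + u * hb
  rw [key x, key y]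

/-- The function `x ↦ ∫ r(x, ζ) dμ(ζ)`, for the canonical measure `μ`, is constant. -/
lemma Connected.exists_canInt_resistance (hG : G.Connected) :
    ∃ c, ∀ x, G.canInt (G.resistance x) = c := by
  obtain ⟨z, g, hg⟩ := hG.exists_isGreen
  refine ⟨green g (.vertex z : G.Point) (.vertex z) - 2 * G.canInt (green g (.vertex z))
    + G.canInt fun y => green g y y, fun x => ?_⟩
  have hc : Continuous (green g x) := by
    simpa only [hg.green_comm _ x] using continuous_green (g := g) x
  have h : G.resistance x = fun y => (green g x x + (-2) * green g x y) + green g y y := by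
    funext y; rw [hg.resistance_eq_green hG]; ring
  have hc' : Continuous fun y => green g x x + (-2) * green g x y :=
    continuous_const.add (hc.const_mul _)
  rw [h, canInt_add hc' continuous_green_self,
    canInt_add continuous_const (hc.const_mul _), canInt_const_mul, hG.canInt_const,
    hg.green_self_sub_canInt hG (.vertex z) x]
  ring

end CanonicalFunctional

end LengthGraph

namespace LengthGraph

variable {V E : Type*} {G : LengthGraph V E}

/-! ### Integrals against signed measures. -/

section SignedMeasures

variable {X : Type*} [MeasurableSpace X]

instance isFiniteMeasure_variation (μ : SignedMeasure X) : IsFiniteMeasure μ.variation := by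
  rw [← SignedMeasure.totalVariation_eq_variation]
  infer_instance

lemma lsmul_real_flip :
    (ContinuousLinearMap.lsmul ℝ ℝ : ℝ →L[ℝ] ℝ →L[ℝ] ℝ).flip = ContinuousLinearMap.lsmul ℝ ℝ := by
  ext; simp

lemma vectorIntegral_toSignedMeasure (P : Measure X) [IsFiniteMeasure P] (f : X → ℝ) :
    ∫ᵛ x, f x ∂•P.toSignedMeasure = ∫ x, f x ∂P := by
  rw [← VectorMeasure.integral_toSignedMeasure, lsmul_real_flip]

lemma vectorIntegral_const (μ : SignedMeasure X) (c : ℝ) : ∫ᵛ _, c ∂•μ = c * μ univ := by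
  rw [VectorMeasure.integral_const]; rfl

end SignedMeasures

/-! ### The canonical measure and identification of the tau constant. -/

section CanonicalMeasure

open Classical

lemma integral_edgeMeasure (e : E) {f : G.Point → ℝ} (hf : Continuous f) :
    ∫ x, f x ∂G.edgeMeasure e = ∫ s in (0 : ℝ)..G.len e, f (G.edgeMap e s) := by
  rw [edgeMeasure, integral_map (continuous_edgeMap e).measurable.aemeasurable
    hf.measurable.aestronglyMeasurable, integral_Icc_eq_integral_Ioc,
    intervalIntegral.integral_of_le (G.len_pos e).le]

variable [Fintype E] [Fintype V]

instance : CompactSpace G.Point := by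
  have h : (univ : Set G.Point) =
      range Point.vertex ∪ ⋃ e, G.edgeMap e '' Icc 0 (G.len e) := by
    refine (eq_univ_of_forall fun x => ?_).symm
    induction x using Point.induction with
    | hv p => exact Or.inl (mem_range_self p)
    | he e s hs =>
      exact Or.inr (mem_iUnion_of_mem e (mem_image_of_mem _ (Ioo_subset_Icc_self hs)))
  constructor
  rw [h]
  exact (finite_range _).isCompact.union
    (isCompact_iUnion fun e => isCompact_Icc.image (continuous_edgeMap e))

instance (e : E) : IsFiniteMeasure (G.edgeMeasure e) := by
  unfold edgeMeasure; infer_instance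

lemma integrable_of_continuous {f : G.Point → ℝ} (hf : Continuous f) (P : Measure G.Point)
    [IsFiniteMeasure P] : Integrable f P :=
  hf.integrable_of_hasCompactSupport (HasCompactSupport.of_compactSpace f)

lemma Connected.canDensity_nonneg (hG : G.Connected) (e : E) : 0 ≤ G.canDensity e := by
  obtain ⟨ρ, h0, -, h⟩ := hG.inv_len_add_deletedResistance e
  rw [canDensity, ← h]; exact h0

lemma Connected.inv_eq_ofReal_canDensity (hG : G.Connected) (e : E) :
    (ENNReal.ofReal (G.len e) + G.deletedResistance e)⁻¹ = ENNReal.ofReal (G.canDensity e) := by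
  obtain ⟨ρ, -, h, h'⟩ := hG.inv_len_add_deletedResistance e
  rw [canDensity, ← h', h]

/-- The canonical measure `∑_p (1 - υ(p)/2) δ_p + ∑_e dx / (L_e + R_e)`. -/
def canMeasure (G : LengthGraph V E) : SignedMeasure G.Point :=
  ∑ p, VectorMeasure.dirac (.vertex p) (1 - (G.valence p : ℝ) / 2)
    + ∑ e, G.canDensity e • (G.edgeMeasure e).toSignedMeasure

lemma integral_canMeasure {f : G.Point → ℝ} (hf : Continuous f) :
    ∫ᵛ x, f x ∂•G.canMeasure = G.canInt f := by
  have hi : ∀ μ : SignedMeasure G.Point, μ.Integrable f := fun μ => integrable_of_continuous hf _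
  rw [canMeasure, VectorMeasure.integral_add_vectorMeasure (hi _) (hi _),
    VectorMeasure.integral_finsetSum_vectorMeasure fun _ _ => hi _,
    VectorMeasure.integral_finsetSum_vectorMeasure fun _ _ => hi _, canInt]
  congr 1
  · refine Finset.sum_congr rfl fun p _ => ?_
    rw [VectorMeasure.integral_dirac' hf.stronglyMeasurable]
    simp [mul_comm]
  · refine Finset.sum_congr rfl fun e _ => ?_
    rw [VectorMeasure.integral_smul_vectorMeasure, vectorIntegral_toSignedMeasure,
      integral_edgeMeasure e hf, smul_eq_mul]

lemma Connected.isCanonicalMeasure (hG : G.Connected) : G.IsCanonicalMeasure G.canMeasure := by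
  obtain ⟨c, hc⟩ := hG.exists_canInt_resistance
  refine ⟨?_, c, fun x => ?_⟩
  · have h := integral_canMeasure (G := G) (continuous_const (y := (1 : ℝ)))
    rwa [vectorIntegral_const, one_mul, hG.canInt_const] at h
  · rw [← hc x, ← integral_canMeasure (hG.continuous_resistance x)]
    -- By definition `voltage ζ x x` is `resistance x ζ`.
    rfl

lemma Connected.continuous_integral_resistance (hG : G.Connected) (P : Measure G.Point)
    [IsFiniteMeasure P] : Continuous fun x => ∫ y, G.resistance x y ∂P := by
  obtain ⟨C, hC⟩ := hG.exists_resistance_le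
  refine continuous_of_edges fun e => Continuous.continuousOn ?_
  refine continuous_of_dominated (bound := fun _ => C)
    (fun s => (hG.continuous_resistance _).measurable.aestronglyMeasurable)
    (fun s => .of_forall fun y => hC _ _) (integrable_const C) (.of_forall fun y => ?_)
  simp only [hG.resistance_comm _ y]
  exact (hG.continuous_resistance y).comp (continuous_edgeMap e)

lemma Connected.canInt_integral_resistance (hG : G.Connected) (P : Measure G.Point)
    [IsFiniteMeasure P] :
    G.canInt (fun x => ∫ y, G.resistance x y ∂P) =
      ∫ y, G.canInt (fun x => G.resistance x y) ∂P := by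
  obtain ⟨C, hC⟩ := hG.exists_resistance_le
  have hswap : ∀ e, ∫ s in (0 : ℝ)..G.len e, ∫ y, G.resistance (G.edgeMap e s) y ∂P =
      ∫ y, (∫ s in (0 : ℝ)..G.len e, G.resistance (G.edgeMap e s) y) ∂P ∧
      Integrable (fun y => ∫ s in (0 : ℝ)..G.len e, G.resistance (G.edgeMap e s) y) P := fun e => by
    have hi : Integrable (Function.uncurry fun s y => G.resistance (G.edgeMap e s) y)
        ((volume.restrict (Ioc 0 (G.len e))).prod P) := by
      refine Integrable.of_bound (C := C) (Measurable.aestronglyMeasurable ?_)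
        (.of_forall fun _ => hC _ _)
      -- Joint measurability comes from continuity in `s` and measurability in `y` (a Carathéodory
      -- function).
      refine measurable_uncurry_of_continuous_of_measurable (fun y => ?_)
        fun s => (hG.continuous_resistance _).measurable
      simp only [hG.resistance_comm _ y]
      exact (hG.continuous_resistance y).comp (continuous_edgeMap e)
    simp only [intervalIntegral.integral_of_le (G.len_pos e).le]
    exact ⟨integral_integral_swap hi, hi.integral_prod_right⟩
  have hv : ∀ p, Integrable (G.resistance (.vertex p)) P := fun p =>
    integrable_of_continuous (hG.continuous_resistance _) P
  simp only [canInt]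
  rw [integral_add (integrable_finsetSum _ fun p _ => (hv p).const_mul _)
    (integrable_finsetSum _ fun e _ => (hswap e).2.const_mul _),
    integral_finsetSum _ fun p _ => (hv p).const_mul _,
    integral_finsetSum _ fun e _ => (hswap e).2.const_mul _]
  simp only [integral_const_mul, fun e => (hswap e).1]

/-- Evaluate the double integral of `r` against `μ` and the explicit canonical measure in both
orders: one gives `d`, the other `c`. Uniqueness of the canonical measure itself is not needed. -/
lemma Connected.voltageInt_eq (hG : G.Connected) {μ : SignedMeasure G.Point} {c d : ℝ}
    (hμ : μ univ = 1) (hd : ∀ x, G.voltageInt μ x x = d)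
    (hc : ∀ x, G.canInt (G.resistance x) = c) : d = c := by
  -- The Jordan decomposition reduces Fubini to positive finite measures.
  set P := μ.toJordanDecomposition.posPart
  set N := μ.toJordanDecomposition.negPart
  have hPN : μ = P.toSignedMeasure - N.toSignedMeasure :=
    (SignedMeasure.toSignedMeasure_toJordanDecomposition μ).symm
  have hint : ∀ f : G.Point → ℝ, Continuous f →
      ∫ᵛ x, f x ∂•μ = ∫ x, f x ∂P - ∫ x, f x ∂N := fun f hf => by
    rw [hPN, VectorMeasure.integral_sub_vectorMeasure (integrable_of_continuous hf _)
      (integrable_of_continuous hf _), vectorIntegral_toSignedMeasure,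
      vectorIntegral_toSignedMeasure]
  have hcan : ∀ (Q : Measure G.Point) [IsFiniteMeasure Q],
      G.canInt (fun x => ∫ y, G.resistance x y ∂Q) = ∫ _, c ∂Q := fun Q _ => by
    rw [hG.canInt_integral_resistance]
    refine integral_congr_ae (.of_forall fun y => ?_)
    simp only [hG.resistance_comm _ y]
    exact hc y
  have h1 : (fun _ : G.Point => d) =
      fun x => ∫ y, G.resistance x y ∂P + (-1) * ∫ y, G.resistance x y ∂N := by
    funext x
    rw [← hd x, neg_one_mul, ← sub_eq_add_neg, ← hint _ (hG.continuous_resistance x)]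
    rfl
  have h2 := hG.canInt_const d
  rw [h1, canInt_add (hG.continuous_integral_resistance P)
    ((hG.continuous_integral_resistance N).const_mul _), canInt_const_mul, hcan, hcan] at h2
  have h3 := hint (fun _ => c) continuous_const
  rw [vectorIntegral_const, hμ] at h3
  linarith

/-- `tau` is a chosen value, possibly from another canonical measure; `voltageInt_eq` makes the
choice irrelevant. -/
lemma Connected.canInt_resistance (hG : G.Connected) (x : G.Point) :
    G.canInt (G.resistance x) = 2 * G.tau := by
  obtain ⟨c, hc⟩ := hG.exists_canInt_resistance
  have hex : ∃ t, G.IsTauConstant t := by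
    obtain ⟨c, hc⟩ := hG.isCanonicalMeasure.2
    exact ⟨1 / 2 * c, G.canMeasure, hG.isCanonicalMeasure, fun x => by rw [hc]⟩
  obtain ⟨μ, ⟨hμ, d, hd⟩, ht⟩ := hex.choose_spec
  rw [tau, dif_pos hex, ht x, hd, hG.voltageInt_eq hμ hd hc, hc]
  ring

end CanonicalMeasure

end LengthGraph

/-! ### The invariants of a polarized graph. -/

namespace PMGraph

open LengthGraph

variable {V E : Type*} [Fintype V] [Fintype E] (Γ : PMGraph V E)

lemma sum_canDiv : ∑ p, (Γ.canDiv p : ℝ) = 2 * Γ.gbar - 2 := by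
  have h := Γ.toLengthGraph.sum_valence_mul (fun _ => 1)
  simp only [mul_one, Finset.sum_const, Finset.card_univ, nsmul_eq_mul] at h
  simp only [canDiv, gbar, genus]
  push_cast
  simp only [Finset.sum_add_distrib, Finset.sum_sub_distrib, h, Finset.sum_const, Finset.card_univ,
    nsmul_eq_mul, ← Finset.mul_sum]
  ring

/-- Effectivity gives the canonical divisor degree `2ḡ - 2 ≥ 0`. -/
lemma gbar_pos : 0 < Γ.gbar := by
  have h : 0 ≤ ∑ p, (Γ.canDiv p : ℝ) :=
    Finset.sum_nonneg fun p _ => Int.cast_nonneg (Γ.effective p)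
  rw [sum_canDiv] at h
  linarith

instance : IsFiniteMeasure Γ.admMeasure := by
  have hd : ∀ p, IsFiniteMeasure ((Γ.q p : ℝ≥0∞) • Measure.dirac (.vertex p : Γ.Point)) :=
    fun p => Measure.smul_finite _ (ENNReal.natCast_ne_top _)
  have he : ∀ e, IsFiniteMeasure (ENNReal.ofReal (Γ.canDensity e) • Γ.edgeMeasure e) :=
    fun e => Measure.smul_finite _ ENNReal.ofReal_ne_top
  simp only [admMeasure, Γ.connected.inv_eq_ofReal_canDensity]
  exact Measure.smul_finite _ ENNReal.ofReal_ne_top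

/-- The vertex weights match because `q = (1 - υ/2) + (υ - 2 + 2q)/2`; the edge parts are identical.
-/
lemma integral_admMeasure {f : Γ.Point → ℝ} (hf : Continuous f) :
    ∫ x, f x ∂Γ.admMeasure =
      1 / Γ.gbar * (Γ.canInt f + 1 / 2 * ∑ p, (Γ.canDiv p : ℝ) * f (.vertex p)) := by
  have hi : ∀ (P : Measure Γ.Point) [IsFiniteMeasure P], Integrable f P :=
    fun P _ => integrable_of_continuous hf P
  simp only [admMeasure, Γ.connected.inv_eq_ofReal_canDensity]
  have hd : ∀ p, Integrable f ((Γ.q p : ℝ≥0∞) • Measure.dirac (.vertex p : Γ.Point)) :=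
    fun p => (hi _).smul_measure (ENNReal.natCast_ne_top _)
  have he : ∀ e, Integrable f (ENNReal.ofReal (Γ.canDensity e) • Γ.edgeMeasure e) :=
    fun e => (hi _).smul_measure ENNReal.ofReal_ne_top
  rw [integral_smul_measure, integral_add_measure (integrable_finsetSum_measure.2 fun p _ => hd p)
    (integrable_finsetSum_measure.2 fun e _ => he e),
    integral_finsetSum_measure fun p _ => hd p, integral_finsetSum_measure fun e _ => he e,
    ENNReal.toReal_ofReal (one_div_nonneg.2 Γ.gbar_pos.le), smul_eq_mul, canInt, Finset.mul_sum,
    add_right_comm, ← Finset.sum_add_distrib]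
  congr 2
  · refine Finset.sum_congr rfl fun p _ => ?_
    rw [integral_smul_measure, integral_dirac' _ _ hf.stronglyMeasurable, canDiv]
    push_cast
    simp
    ring
  · refine Finset.sum_congr rfl fun e _ => ?_
    rw [integral_smul_measure, ENNReal.toReal_ofReal (Γ.connected.canDensity_nonneg e),
      integral_edgeMeasure e hf, smul_eq_mul]

lemma integral_deltaK {f : Γ.Point → ℝ} (hf : Continuous f) :
    ∫ᵛ x, f x ∂•Γ.deltaK = ∑ p, (Γ.canDiv p : ℝ) * f (.vertex p) := by
  rw [deltaK, VectorMeasure.integral_finsetSum_vectorMeasure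
    fun _ _ => integrable_of_continuous hf _]
  refine Finset.sum_congr rfl fun p _ => ?_
  rw [VectorMeasure.integral_dirac' hf.stronglyMeasurable]
  simp [mul_comm]

lemma integral_resistance_admMeasure (y : Γ.Point) :
    ∫ x, Γ.resistance y x ∂Γ.admMeasure = 1 / Γ.gbar *
      (2 * Γ.tau + 1 / 2 * ∑ p, (Γ.canDiv p : ℝ) * Γ.resistance y (.vertex p)) := by
  rw [integral_admMeasure Γ (Γ.connected.continuous_resistance y), Γ.connected.canInt_resistance]

lemma integral_sum_canDiv_mul_resistance :
    ∫ y, ∑ p, (Γ.canDiv p : ℝ) * Γ.resistance (.vertex p) y ∂Γ.admMeasure =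
      1 / Γ.gbar * ((2 * Γ.gbar - 2) * (2 * Γ.tau) + 1 / 2 * Γ.theta) := by
  rw [integral_finsetSum _ fun p _ =>
    (integrable_of_continuous (Γ.connected.continuous_resistance _) _).const_mul _]
  simp only [integral_const_mul, integral_resistance_admMeasure, theta]
  rw [← sum_canDiv, Finset.sum_mul, Finset.mul_sum, ← Finset.sum_add_distrib, Finset.mul_sum]
  refine Finset.sum_congr rfl fun p _ => ?_
  simp only [mul_assoc, ← Finset.mul_sum]
  ring

lemma epsilon_eq :
    Γ.epsilon = (4 * Γ.gbar - 4) * Γ.tau / Γ.gbar + Γ.theta / (2 * Γ.gbar) := by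
  have h : ∀ y, ∫ᵛ x, Γ.resistance x y ∂•Γ.deltaK =
      ∑ p, (Γ.canDiv p : ℝ) * Γ.resistance (.vertex p) y := fun y => by
    simp only [Γ.connected.resistance_comm _ y]
    exact Γ.integral_deltaK (Γ.connected.continuous_resistance y)
  have hg := Γ.gbar_pos.ne'
  simp only [epsilon, h, integral_sum_canDiv_mul_resistance]
  field_simp
  ring

lemma aInv_eq :
    Γ.aInv = (2 * Γ.gbar - 1) * Γ.tau / Γ.gbar ^ 2 + Γ.theta / (8 * Γ.gbar ^ 2) := by
  have hg := Γ.gbar_pos.ne'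
  have h : ∀ y, ∫ x, Γ.resistance x y ∂Γ.admMeasure = 1 / Γ.gbar *
      (2 * Γ.tau + 1 / 2 * ∑ p, (Γ.canDiv p : ℝ) * Γ.resistance (.vertex p) y) := fun y => by
    simp only [Γ.connected.resistance_comm _ y]
    exact Γ.integral_resistance_admMeasure y
  -- The admissible measure has mass `(1 + (2ḡ - 2)/2)/ḡ = 1`.
  have hc : ∫ _, 2 * Γ.tau ∂Γ.admMeasure = 2 * Γ.tau := by
    rw [integral_admMeasure Γ continuous_const, Γ.connected.canInt_const, ← Finset.sum_mul,
      sum_canDiv]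
    field_simp
    ring
  have hS : Integrable (fun y => ∑ p, (Γ.canDiv p : ℝ) * Γ.resistance (.vertex p) y)
      Γ.admMeasure := integrable_finsetSum _ fun p _ =>
    (integrable_of_continuous (Γ.connected.continuous_resistance _) _).const_mul _
  simp only [aInv, h]
  rw [integral_const_mul, integral_add (integrable_const _) (hS.const_mul _), hc,
    integral_const_mul, integral_sum_canDiv_mul_resistance]
  field_simp
  ring

end PMGraph

end

theorem mainTheorem11 {V E : Type*} [Fintype V] [Fintype E] (Γ : PMGraph V E) :
    Γ.phi = (5 * Γ.gbar - 2) * Γ.tau / Γ.gbar + Γ.theta / (4 * Γ.gbar) - Γ.totalLength / 4 ∧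
    Γ.epsilon = (4 * Γ.gbar - 4) * Γ.tau / Γ.gbar + Γ.theta / (2 * Γ.gbar) ∧
    Γ.aInv = (2 * Γ.gbar - 1) * Γ.tau / Γ.gbar ^ 2 + Γ.theta / (8 * Γ.gbar ^ 2) := by
  refine ⟨?_, Γ.epsilon_eq, Γ.aInv_eq⟩
  have hg := Γ.gbar_pos.ne'
  rw [PMGraph.phi, Γ.epsilon_eq, Γ.aInv_eq]
  field_simp
  ring
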